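/- For a positive integer $n$ and finite simple graphs $T$ and $H$, let $\mathrm{ex}(n,T,H)$ denote the maximum number of copies of $T$ (subgraphs isomorphic to $T$, not necessarily induced) in a simple graph on $n$ vertices that contains no subgraph isomorphic to $H$. Let $C_\ell$ denote the cycle of length $\ell$. Then for every odd integer $k \ge 7$, $$\mathrm{ex}(n, C_k, C_{k-2}) = \left(\frac{n}{k}\right)^k + o(n^k) \qquad (n \to \infty,\ k \text{ fixed}).$$ -/

import Mathlib

open scoped Classical in
/-- The generalized Turán number `ex(n, T, H)`: the maximum number of (unlabelled, not necessarily
induced) copies of `T` in an `H`-free simple graph on `n` vertices. If there is no `H`-free simple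
graph on `n` vertices, then this is `0`. -/
noncomputable def SimpleGraph.generalizedTuranNumber (n : ℕ) {U : Type*} (T : SimpleGraph U)
    {W : Type*} (H : SimpleGraph W) : ℕ :=
  Finset.sup {G : SimpleGraph (Fin n) | H.Free G} (fun G => G.copyCount T)

/-!
Write `n` for the number of vertices. A graph without cycles of length `k - 2` has `O(n ^ (k - 3))`
closed walks of length `k - 2`, since none of them is injective. By Cauchy–Schwarz for traces of
powers of the adjacency matrix, a graph with few closed walks of odd length `l + 2` has few of
length `l`, so closed walks of every odd length at most `k - 2` are rare.

Discard the homomorphisms `f` of the `k`-cycle that have a chord `f i ~ f (i + 3)`, or a pair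
`f i, f (i + 2)` with few common neighbours. The others are counted by choosing the images in the
order `0, 1, 3, 2, 4, 5, …, k - 1`: the image of `2` is a common neighbour of those of `1` and `3`,
that of `3` is far from that of `0`, and that of `t ≥ 4` is adjacent to that of `t - 1` and far from
those of `0, …, t - 2`. If the candidate sets have at most `c_t` elements on average then AM–GM
bounds the count by `∏ c_t`. Averaging over the symmetries of the cycle, a vertex `z` is
counted with a total weight depending only on the residues `j` for which `z` is near `f j`. This
weight is at most `2 k - 2` unless `z` lies on a short odd closed walk, and this gives
`2 k (n / k) ^ k + o(n ^ k)` homomorphisms, `2 k` for each copy. Blow-ups of the `k`-cycle match it.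
-/

namespace CycleTuran

open Finset SimpleGraph Function

section Sums

theorem sum_prod_consecutive_mul {V R : Type*} [Fintype V] [DecidableEq V] [CommSemiring R]
    (B : Matrix V V R) (d : ℕ) (F : V → V → R) :
    ∑ f : Fin (d + 1) → V, (∏ t : Fin d, B (f t.castSucc) (f t.succ)) * F (f 0) (f (Fin.last d))
      = ∑ u, ∑ v, (B ^ d) u v * F u v := by
  induction d generalizing F with
  | zero =>
    rw [← (Equiv.funUnique (Fin 1) V).symm.sum_comp]
    simp [Matrix.one_apply]
  | succ d ih =>
    have snoc_zero (g : Fin (d + 1) → V) (x : V) : (Fin.snoc g x : Fin (d + 2) → V) 0 = g 0 := by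
      rw [← Fin.castSucc_zero, Fin.snoc_castSucc]
    calc _ = ∑ g : Fin (d + 1) → V, (∏ t : Fin d, B (g t.castSucc) (g t.succ)) *
            ∑ x, B (g (Fin.last d)) x * F (g 0) x := by
          rw [← (Fin.snocEquiv fun _ : Fin (d + 2) => V).sum_comp, Fintype.sum_prod_type_right]
          simp only [Fin.snocEquiv, Equiv.coe_fn_mk, Fin.prod_univ_castSucc, Fin.snoc_castSucc,
            Fin.succ_castSucc, Fin.succ_last, Fin.snoc_last, snoc_zero, mul_sum, mul_assoc]
      _ = ∑ u, ∑ v, (B ^ d) u v * ∑ x, B v x * F u x := ih fun u v => ∑ x, B v x * F u x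
      _ = _ := by
          refine sum_congr rfl fun u _ => ?_
          simp only [pow_succ, Matrix.mul_apply, mul_sum, sum_mul, mul_assoc]
          exact sum_comm

theorem sum_comp_castAdd {V R : Type*} [Fintype V] [CommSemiring R] (m r : ℕ)
    (F : (Fin m → V) → R) :
    ∑ f : Fin (m + r) → V, F (fun i => f (Fin.castAdd r i))
      = (Fintype.card V : R) ^ r * ∑ g : Fin m → V, F g := by
  classical
  rw [← (Fin.appendEquiv m r).sum_comp, Fintype.sum_prod_type_right]
  simp [Fin.appendEquiv, mul_sum]

theorem natCast_fin_bijective (k : ℕ) [NeZero k] :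
    Bijective fun i : Fin k => ((i : ℕ) : ZMod k) := by
  refine (Fintype.bijective_iff_injective_and_card _).2 ⟨fun i j h => Fin.ext ?_, by simp⟩
  simpa [ZMod.natCast_eq_natCast_iff', Nat.mod_eq_of_lt] using h

theorem sum_comp_natCast_fin {V R : Type*} [Fintype V] [AddCommMonoid R] (k : ℕ) [NeZero k]
    (F : (Fin k → V) → R) :
    ∑ f : ZMod k → V, F (fun i => f ((i : ℕ) : ZMod k)) = ∑ g : Fin k → V, F g :=
  Fintype.sum_equiv ((Equiv.ofBijective _ (natCast_fin_bijective k)).symm.arrowCongr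
    (Equiv.refl V)) _ _ fun _ => rfl

theorem sum_comp_equiv_of_mem {ι W R : Type*} [AddCommMonoid R] (s : Finset (ι → W)) (e : ι ≃ ι)
    (h : ∀ f, f ∘ e ∈ s ↔ f ∈ s) (F : (ι → W) → R) :
    ∑ f ∈ s, F (f ∘ e) = ∑ f ∈ s, F f :=
  sum_equiv (e.symm.arrowCongr (Equiv.refl W)) (fun f => (h f).symm) fun _ _ => rfl

theorem sum_sum_pow_four_le {V W : Type*} [Fintype V] [Fintype W] (f : V → W → ℝ) :
    (∑ a, ∑ b, f a b) ^ 4 ≤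
      (Fintype.card V * Fintype.card W : ℝ) ^ 2 * ∑ a, ∑ a', (∑ b, f a b * f a' b) ^ 2 := by
  have h₁ : (∑ a, ∑ b, f a b) ^ 2 ≤ (Fintype.card W : ℝ) * ∑ a, ∑ a', ∑ b, f a b * f a' b := by
    calc (∑ a, ∑ b, f a b) ^ 2 = (∑ b, ∑ a, f a b) ^ 2 := by rw [sum_comm]
      _ ≤ Fintype.card W * ∑ b, (∑ a, f a b) ^ 2 := sq_sum_le_card_mul_sum_sq
      _ = _ := by
        simp_rw [sq, sum_mul_sum]
        rw [sum_comm]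
        exact congrArg _ (sum_congr rfl fun a _ => sum_comm)
  have h₂ : (∑ a, ∑ a', ∑ b, f a b * f a' b) ^ 2 ≤
      (Fintype.card V : ℝ) ^ 2 * ∑ a, ∑ a', (∑ b, f a b * f a' b) ^ 2 := by
    simpa [Fintype.sum_prod_type, sq] using
      sq_sum_le_card_mul_sum_sq (s := univ) (f := fun x : V × V => ∑ b, f x.1 b * f x.2 b)
  calc (∑ a, ∑ b, f a b) ^ 4 = ((∑ a, ∑ b, f a b) ^ 2) ^ 2 := by ring
    _ ≤ ((Fintype.card W : ℝ) * ∑ a, ∑ a', ∑ b, f a b * f a' b) ^ 2 := by gcongr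
    _ = (Fintype.card W : ℝ) ^ 2 * (∑ a, ∑ a', ∑ b, f a b * f a' b) ^ 2 := by ring
    _ ≤ (Fintype.card W : ℝ) ^ 2 *
          ((Fintype.card V : ℝ) ^ 2 * ∑ a, ∑ a', (∑ b, f a b * f a' b) ^ 2) := by gcongr
    _ = _ := by ring

theorem sum_mul_pow_four_le {ι : Type*} (s : Finset ι) {w : ι → ℝ} (hw : ∀ i ∈ s, 0 ≤ w i)
    (x : ι → ℝ) :
    (∑ i ∈ s, w i * x i) ^ 4 ≤ (∑ i ∈ s, w i) ^ 3 * ∑ i ∈ s, w i * x i ^ 4 := by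
  have sq_le (y : ι → ℝ) : (∑ i ∈ s, w i * y i) ^ 2 ≤ (∑ i ∈ s, w i) * ∑ i ∈ s, w i * y i ^ 2 :=
    sum_sq_le_sum_mul_sum_of_sq_le_mul s hw
      (fun i hi => mul_nonneg (hw i hi) (sq_nonneg _)) (fun i _ => le_of_eq (by ring))
  calc (∑ i ∈ s, w i * x i) ^ 4 = ((∑ i ∈ s, w i * x i) ^ 2) ^ 2 := by ring
    _ ≤ ((∑ i ∈ s, w i) * ∑ i ∈ s, w i * x i ^ 2) ^ 2 :=
        pow_le_pow_left₀ (sq_nonneg _) (sq_le x) 2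
    _ = (∑ i ∈ s, w i) ^ 2 * (∑ i ∈ s, w i * x i ^ 2) ^ 2 := by ring
    _ ≤ (∑ i ∈ s, w i) ^ 2 * ((∑ i ∈ s, w i) * ∑ i ∈ s, w i * (x i ^ 2) ^ 2) := by
        gcongr; exact sq_le _
    _ = _ := by simp_rw [← pow_mul]; ring

theorem card_filter_apply_eq_apply_le {ι V : Type*} [Fintype ι] [DecidableEq ι] [Fintype V]
    [DecidableEq V] {i j : ι} (hij : i ≠ j) :
    #{f : ι → V | f i = f j} ≤ Fintype.card V ^ (Fintype.card ι - 1) := by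
  have hcard : Fintype.card V ^ (Fintype.card ι - 1)
      = #(univ : Finset ({l // l ≠ j} → V)) := by
    simp
  rw [hcard]
  refine card_le_card_of_injOn (fun f l => f l) (fun _ _ => mem_coe.2 (mem_univ _)) ?_
  intro f hf g hg hfg
  have agree (l : ι) (hl : l ≠ j) : f l = g l := congrFun hfg ⟨l, hl⟩
  simp only [coe_filter, mem_univ, true_and, Set.mem_ofPred_eq] at hf hg
  funext l
  rcases eq_or_ne l j with rfl | hl
  · rw [← hf, ← hg, agree i hij]
  · exact agree l hl

theorem card_filter_not_injective_le {ι V : Type*} [Fintype ι] [DecidableEq ι] [Fintype V]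
    [DecidableEq V] :
    #{f : ι → V | ¬ Injective f} ≤
      Fintype.card ι ^ 2 * Fintype.card V ^ (Fintype.card ι - 1) := by
  have hsub : ({f : ι → V | ¬ Injective f} : Finset (ι → V)) ⊆
      (univ : Finset ι).offDiag.biUnion fun p => {f : ι → V | f p.1 = f p.2} := fun f hf => by
    simpa [Injective, and_comm] using hf
  calc #{f : ι → V | ¬ Injective f}
      ≤ #(univ : Finset ι).offDiag * Fintype.card V ^ (Fintype.card ι - 1) :=
        (card_le_card hsub).trans <| card_biUnion_le_card_mul _ _ _ fun p hp =>
          card_filter_apply_eq_apply_le (mem_offDiag.1 hp).2.2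
    _ ≤ _ := by
        gcongr
        rw [offDiag_card, card_univ, sq]
        exact Nat.sub_le _ _

end Sums

section Walks

variable {V : Type*} (G : SimpleGraph V) [DecidableRel G.Adj]

theorem adjMatrix_nonneg (u v : V) : 0 ≤ G.adjMatrix ℝ u v := by
  rw [adjMatrix_apply]; split_ifs <;> norm_num

theorem adjMatrix_le_one (u v : V) : G.adjMatrix ℝ u v ≤ 1 := by
  rw [adjMatrix_apply]; split_ifs <;> norm_num

variable [Fintype V] [DecidableEq V]

theorem adjMatrix_pow_nonneg (d : ℕ) (u v : V) : 0 ≤ (G.adjMatrix ℝ ^ d) u v := by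
  rw [adjMatrix_pow_apply_eq_card_walk]; positivity

theorem adjMatrix_pow_comm (d : ℕ) (u v : V) :
    (G.adjMatrix ℝ ^ d) u v = (G.adjMatrix ℝ ^ d) v u :=
  ((G.isSymm_adjMatrix).pow d).apply v u

theorem trace_adjMatrix_pow_add (a b : ℕ) :
    (G.adjMatrix ℝ ^ (a + b)).trace =
      ∑ u, ∑ v, (G.adjMatrix ℝ ^ a) u v * (G.adjMatrix ℝ ^ b) u v := by
  simp only [pow_add, Matrix.trace, Matrix.diag_apply, Matrix.mul_apply]
  exact sum_congr rfl fun u _ => sum_congr rfl fun v _ => by rw [adjMatrix_pow_comm G b u v]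

theorem sum_adjMatrix_pow_le (d : ℕ) :
    ∑ u, ∑ v, (G.adjMatrix ℝ ^ d) u v ≤ (Fintype.card V : ℝ) ^ (d + 1) := by
  have h := sum_prod_consecutive_mul (G.adjMatrix ℝ) d fun _ _ => 1
  simp only [mul_one] at h
  rw [← h]
  refine (sum_le_card_nsmul _ _ 1 fun f _ => ?_).trans_eq (by simp)
  exact prod_le_one (fun _ _ => adjMatrix_nonneg G _ _) fun _ _ => adjMatrix_le_one G _ _

theorem adjMatrix_pow_three_pow_four_le (q p : V) :
    (G.adjMatrix ℝ ^ 3) q p ^ 4 ≤ (Fintype.card V : ℝ) ^ 4 * (G.adjMatrix ℝ ^ 5) q p := by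
  set A := G.adjMatrix ℝ
  have nonneg : ∀ u v, 0 ≤ A u v := adjMatrix_nonneg G
  have le_one : ∀ u v, A u v ≤ 1 := adjMatrix_le_one G
  have symm : ∀ u v, A u v = A v u := fun u v => G.isSymm_adjMatrix.apply v u
  have pow_three : (A ^ 3) q p = ∑ a, ∑ b, A q a * A a b * A b p := by
    rw [show A ^ 3 = A * (A * A) by noncomm_ring]
    simp only [Matrix.mul_apply, mul_sum, mul_assoc]
  have pow_five : (A ^ 5) q p =
      ∑ a, ∑ a', ∑ b, ∑ b', A q a * A a b * A a' b * A a' b' * A b' p := by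
    rw [show A ^ 5 = A * (A * (A * (A * A))) by noncomm_ring]
    simp only [Matrix.mul_apply, mul_sum, mul_assoc]
    refine sum_congr rfl fun a _ => sum_comm.trans <| sum_congr rfl fun a' _ =>
      sum_congr rfl fun b _ => sum_congr rfl fun b' _ => ?_
    rw [symm b a']
  rw [pow_three, pow_five]
  refine (sum_sum_pow_four_le fun a b => A q a * A a b * A b p).trans ?_
  rw [show (Fintype.card V * Fintype.card V : ℝ) ^ 2 = (Fintype.card V : ℝ) ^ 4 by ring]
  gcongr with a _ a' _
  rw [sq, sum_mul_sum]
  -- Of the twelve factors keep those along the walk `q, a, b, a', b', p`.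
  refine sum_le_sum fun b _ => sum_le_sum fun b' _ => ?_
  calc A q a * A a b * A b p * (A q a' * A a' b * A b p) *
        (A q a * A a b' * A b' p * (A q a' * A a' b' * A b' p))
      ≤ A q a * A a b * 1 * (1 * A a' b * 1) * (1 * 1 * A b' p * (1 * A a' b' * 1)) := by
        gcongr <;> repeat' first
          | exact le_one _ _ | exact nonneg _ _ | exact zero_le_one | apply mul_nonneg
    _ = _ := by ring

theorem trace_adjMatrix_pow_pow_four_le (d : ℕ) :
    (G.adjMatrix ℝ ^ (d + 3)).trace ^ 4
      ≤ (Fintype.card V : ℝ) ^ (3 * d + 7) * (G.adjMatrix ℝ ^ (d + 5)).trace := by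
  have nonneg : ∀ u v, 0 ≤ (G.adjMatrix ℝ ^ d) u v := adjMatrix_pow_nonneg G d
  have jensen := sum_mul_pow_four_le univ
    (w := fun x : V × V => (G.adjMatrix ℝ ^ d) x.1 x.2) (fun x _ => nonneg x.1 x.2)
    fun x => (G.adjMatrix ℝ ^ 3) x.1 x.2
  simp only [Fintype.sum_prod_type] at jensen
  rw [trace_adjMatrix_pow_add, trace_adjMatrix_pow_add]
  calc _ ≤ _ := jensen
    _ ≤ ((Fintype.card V : ℝ) ^ (d + 1)) ^ 3 * ∑ u, ∑ v, (G.adjMatrix ℝ ^ d) u v *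
          ((Fintype.card V : ℝ) ^ 4 * (G.adjMatrix ℝ ^ 5) u v) := by
        gcongr with u _ v _
        · exact sum_nonneg fun u _ => sum_nonneg fun v _ =>
            mul_nonneg (nonneg u v) (by positivity)
        · exact sum_nonneg fun u _ => sum_nonneg fun v _ => nonneg u v
        · exact sum_adjMatrix_pow_le G d
        · exact nonneg u v
        · exact adjMatrix_pow_three_pow_four_le G u v
    _ = _ := by
        simp_rw [mul_left_comm _ ((Fintype.card V : ℝ) ^ 4), ← mul_sum]
        ring

theorem trace_adjMatrix_pow_le_of_add_two {l : ℕ} (hl : 3 ≤ l) {ε : ℝ} (hε : 0 ≤ ε)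
    (h : (G.adjMatrix ℝ ^ (l + 2)).trace ≤ ε ^ 4 * (Fintype.card V : ℝ) ^ (l + 2)) :
    (G.adjMatrix ℝ ^ l).trace ≤ ε * (Fintype.card V : ℝ) ^ l := by
  obtain ⟨d, rfl⟩ := Nat.exists_eq_add_of_le' hl
  refine le_of_pow_le_pow_left₀ (n := 4) (by norm_num) (by positivity) ?_
  calc (G.adjMatrix ℝ ^ (d + 3)).trace ^ 4
      ≤ (Fintype.card V : ℝ) ^ (3 * d + 7) * (G.adjMatrix ℝ ^ (d + 5)).trace :=
        trace_adjMatrix_pow_pow_four_le G d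
    _ ≤ (Fintype.card V : ℝ) ^ (3 * d + 7) * (ε ^ 4 * (Fintype.card V : ℝ) ^ (d + 5)) := by
        gcongr
    _ = (ε * (Fintype.card V : ℝ) ^ (d + 3)) ^ 4 := by ring

theorem trace_adjMatrix_pow_le_of_add_two_mul {l : ℕ} (hl : 3 ≤ l) {ε : ℝ} (hε : 0 ≤ ε) (s : ℕ)
    (h : (G.adjMatrix ℝ ^ (l + 2 * s)).trace
      ≤ ε ^ 4 ^ s * (Fintype.card V : ℝ) ^ (l + 2 * s)) :
    (G.adjMatrix ℝ ^ l).trace ≤ ε * (Fintype.card V : ℝ) ^ l := by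
  induction s with
  | zero => simpa using h
  | succ s ih =>
    refine ih (trace_adjMatrix_pow_le_of_add_two G (by omega) (by positivity) ?_)
    rwa [← pow_mul, ← pow_succ]

theorem trace_adjMatrix_pow_le_of_odd {m : ℕ} (hm : Odd m) {ε : ℝ} (hε : 0 ≤ ε) (hε' : ε ≤ 1)
    (h : (G.adjMatrix ℝ ^ m).trace ≤ ε ^ 4 ^ m * (Fintype.card V : ℝ) ^ m) {l : ℕ} (hl : Odd l)
    (hl3 : 3 ≤ l) (hlm : l ≤ m) :
    (G.adjMatrix ℝ ^ l).trace ≤ ε * (Fintype.card V : ℝ) ^ l := by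
  obtain ⟨s, rfl⟩ : ∃ s, m = l + 2 * s := by
    obtain ⟨a, rfl⟩ := hm
    obtain ⟨b, rfl⟩ := hl
    exact ⟨a - b, by omega⟩
  refine trace_adjMatrix_pow_le_of_add_two_mul G hl3 hε s (h.trans ?_)
  gcongr ?_ * _
  exact pow_le_pow_of_le_one hε hε' (Nat.pow_le_pow_right (by norm_num) (by omega))

end Walks

section CycleHoms

variable {V : Type*} [Fintype V] (G : SimpleGraph V) [DecidableRel G.Adj]

/-- The homomorphisms from the cycle of length `k` to `G`, with the vertices of the cycle indexed by
`ZMod k`. As closed walks they make sense for every `k ≠ 0`. -/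
def cycleHoms (k : ℕ) [NeZero k] : Finset (ZMod k → V) :=
  {f | ∀ i, G.Adj (f i) (f (i + 1))}

variable {G} {k : ℕ} [NeZero k]

theorem mem_cycleHoms {f : ZMod k → V} : f ∈ cycleHoms G k ↔ ∀ i, G.Adj (f i) (f (i + 1)) := by
  simp [cycleHoms]

theorem comp_addRight_mem_cycleHoms (c : ZMod k) {f : ZMod k → V} :
    f ∘ Equiv.addRight c ∈ cycleHoms G k ↔ f ∈ cycleHoms G k := by
  simp only [mem_cycleHoms, comp_apply, Equiv.coe_addRight]
  refine ⟨fun h i => ?_, fun h i => ?_⟩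
  · simpa [add_right_comm] using h (i - c)
  · simpa [add_right_comm] using h (i + c)

theorem comp_neg_mem_cycleHoms {f : ZMod k → V} :
    f ∘ Equiv.neg (ZMod k) ∈ cycleHoms G k ↔ f ∈ cycleHoms G k := by
  simp only [mem_cycleHoms, comp_apply, Equiv.neg_apply]
  refine ⟨fun h i => ?_, fun h i => ?_⟩
  · simpa using (h (-(i + 1))).symm
  · simpa using (h (-(i + 1))).symm

theorem sum_cycleHoms_comp_addRight (c : ZMod k) (F : (ZMod k → V) → ℝ) :
    ∑ f ∈ cycleHoms G k, F (f ∘ Equiv.addRight c) = ∑ f ∈ cycleHoms G k, F f :=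
  sum_comp_equiv_of_mem _ _ (fun _ => comp_addRight_mem_cycleHoms c) F

/-- The homomorphism out of `SimpleGraph.cycleGraph` given by a closed walk. -/
def homOfMemCycleHoms {m : ℕ} (f : ZMod (m + 1) → V) (hf : f ∈ cycleHoms G (m + 1)) :
    cycleGraph (m + 1) →g G where
  toFun := f
  map_rel' {a b} hab := by
    rw [mem_cycleHoms] at hf
    rw [cycleGraph_eq_circulantGraph, circulantGraph_adj, Set.mem_singleton_iff,
      Set.mem_singleton_iff, sub_eq_iff_eq_add', sub_eq_iff_eq_add'] at hab
    rcases hab.2 with rfl | rfl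
    · exact (hf b).symm
    · exact hf a

theorem card_cycleHoms_le_of_free (h : (cycleGraph k).Free G) :
    #(cycleHoms G k) ≤ k ^ 2 * Fintype.card V ^ (k - 1) := by
  classical
  obtain ⟨m, rfl⟩ := Nat.exists_eq_succ_of_ne_zero (NeZero.ne k)
  have hsub : cycleHoms G (m + 1) ⊆
      ({f | ¬ Injective f} : Finset (ZMod (m + 1) → V)) := fun f hf =>
    mem_filter.2 ⟨mem_univ f, fun hinj => h ⟨⟨homOfMemCycleHoms f hf, hinj⟩⟩⟩
  simpa using (card_le_card hsub).trans card_filter_not_injective_le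

variable (G) [DecidableEq V]

theorem sum_cycleHoms_le {d : ℕ} (hd : d + 1 ≤ k) (i : ZMod k) {M : V → V → ℝ}
    (hM : ∀ u v, 0 ≤ M u v) :
    ∑ f ∈ cycleHoms G k, M (f i) (f (i + d))
      ≤ (Fintype.card V : ℝ) ^ (k - d - 1) * ∑ u, ∑ v, (G.adjMatrix ℝ ^ d) u v * M u v := by
  obtain ⟨r, rfl⟩ := Nat.exists_eq_add_of_le hd
  set A := G.adjMatrix ℝ
  let walkProd (f : ZMod (d + 1 + r) → V) : ℝ := ∏ t : Fin d, A (f (t : ℕ)) (f ((t : ℕ) + 1))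
  have walkProd_nonneg (f) : 0 ≤ walkProd f := prod_nonneg fun _ _ => adjMatrix_nonneg G _ _
  have walkProd_eq_one (f) (hf : f ∈ cycleHoms G (d + 1 + r)) : walkProd f = 1 :=
    prod_eq_one fun t _ => by simp [A, mem_cycleHoms.1 hf]
  calc ∑ f ∈ cycleHoms G (d + 1 + r), M (f i) (f (i + d))
      = ∑ f ∈ cycleHoms G (d + 1 + r), M (f 0) (f d) := by
        rw [← sum_cycleHoms_comp_addRight i fun f => M (f 0) (f d)]
        simp [add_comm]
    _ = ∑ f ∈ cycleHoms G (d + 1 + r), walkProd f * M (f 0) (f d) :=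
        sum_congr rfl fun f hf => by rw [walkProd_eq_one f hf, one_mul]
    _ ≤ ∑ f, walkProd f * M (f 0) (f d) :=
        sum_le_sum_of_subset_of_nonneg (subset_univ _) fun f _ _ =>
          mul_nonneg (walkProd_nonneg f) (hM _ _)
    _ = _ := by
        rw [show d + 1 + r - d - 1 = r by omega, ← sum_prod_consecutive_mul, ← sum_comp_castAdd,
          ← sum_comp_natCast_fin]
        simp [walkProd]

theorem card_cycleHoms_eq_trace (k : ℕ) [NeZero k] :
    (#(cycleHoms G k) : ℝ) = (G.adjMatrix ℝ ^ k).trace := by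
  obtain ⟨m, rfl⟩ := Nat.exists_eq_succ_of_ne_zero (NeZero.ne k)
  have trace_eq : (G.adjMatrix ℝ ^ (m + 1)).trace =
      ∑ f : Fin (m + 1) → V, ∏ i, G.adjMatrix ℝ (f i) (f (i + 1)) := by
    rw [trace_adjMatrix_pow_add, pow_one]
    refine (sum_prod_consecutive_mul _ m fun u v => G.adjMatrix ℝ u v).symm.trans ?_
    refine sum_congr rfl fun f _ => ?_
    rw [Fin.prod_univ_castSucc]
    simp [Fin.last_add_one, G.adj_comm]
  have prod_eq (f : ZMod (m + 1) → V) : ∏ i, G.adjMatrix ℝ (f i) (f (i + 1)) =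
      if f ∈ cycleHoms G (m + 1) then 1 else 0 := by
    simp only [adjMatrix_apply, mem_cycleHoms, prod_boole, mem_univ, true_implies]
  calc (#(cycleHoms G (m + 1)) : ℝ)
      = ∑ f : ZMod (m + 1) → V, ∏ i, G.adjMatrix ℝ (f i) (f (i + 1)) := by
        rw [sum_congr rfl fun f _ => prod_eq f]; simp
    _ = _ := trace_eq.symm

variable {G}

theorem trace_adjMatrix_pow_le_of_free (h : (cycleGraph k).Free G) :
    (G.adjMatrix ℝ ^ k).trace ≤ (k : ℝ) ^ 2 * (Fintype.card V : ℝ) ^ (k - 1) := by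
  rw [← card_cycleHoms_eq_trace]
  exact_mod_cast card_cycleHoms_le_of_free h

end CycleHoms

section SequentialChoice

theorem sum_sum_update {ι V : Type*} [Fintype ι] [DecidableEq ι] [Fintype V] (a : ι)
    (F : (ι → V) → ℝ) :
    ∑ u : ι → V, ∑ x, F (update u a x) = (Fintype.card V : ℝ) * ∑ u, F u := by
  have hinv : Involutive fun y : (ι → V) × V => (update y.1 a y.2, y.1 a) := by
    rintro ⟨u, x⟩
    simp
  calc ∑ u : ι → V, ∑ x, F (update u a x)
      = ∑ y : (ι → V) × V, F (update y.1 a y.2) :=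
        (Fintype.sum_prod_type' fun u x => F (update u a x)).symm
    _ = ∑ y : (ι → V) × V, F y.1 :=
        Equiv.sum_comp hinv.toPerm fun y : (ι → V) × V => F y.1
    _ = _ := by simp [Fintype.sum_prod_type, mul_sum]

theorem one_add_sum_one_sub_le_prod_inv {ι : Type*} (s : Finset ι) {x : ι → ℝ}
    (hx : ∀ i ∈ s, 0 < x i) : 1 + ∑ i ∈ s, (1 - x i) ≤ ∏ i ∈ s, (x i)⁻¹ := by
  calc 1 + ∑ i ∈ s, (1 - x i) ≤ Real.exp (∑ i ∈ s, (1 - x i)) := by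
        linarith [Real.add_one_le_exp (∑ i ∈ s, (1 - x i))]
    _ = ∏ i ∈ s, Real.exp (1 - x i) := Real.exp_sum _ _
    _ ≤ ∏ i ∈ s, (x i)⁻¹ := prod_le_prod (fun _ _ => (Real.exp_pos _).le) fun i hi => by
        rw [← neg_sub, Real.exp_neg]
        exact inv_anti₀ (hx i hi) (by linarith [Real.add_one_le_exp (x i - 1)])

variable {ι α V : Type*} [LinearOrder α] [DecidableEq V] {r : ι → α} {S : ι → (ι → V) → Finset V}

/-- The conditional probability of the value `u j` when it is chosen uniformly from the set `S j u`
of candidates. -/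
noncomputable def choiceProb (S : ι → (ι → V) → Finset V) (j : ι) (u : ι → V) : ℝ :=
  if u j ∈ S j u then (#(S j u) : ℝ)⁻¹ else 0

theorem choiceProb_nonneg (j : ι) (u : ι → V) : 0 ≤ choiceProb S j u := by
  unfold choiceProb; split_ifs <;> positivity

variable [DecidableEq ι] [Fintype V]

theorem sum_prod_insert_choiceProb_le
    (hS : ∀ j u u', (∀ i, r i < r j → u i = u' i) → S j u = S j u')
    {a : ι} {s : Finset ι} (ha : a ∉ s) (hmax : ∀ j ∈ s, r j ≤ r a) (u : ι → V) :
    ∑ x, ∏ j ∈ insert a s, choiceProb S j (update u a x) ≤ ∏ j ∈ s, choiceProb S j u := by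
  have stable (j : ι) (hj : r j ≤ r a) (x : V) : S j (update u a x) = S j u :=
    hS _ _ _ fun i hi => update_of_ne (by rintro rfl; exact (hi.trans_le hj).false) _ _
  have prob_update (x : V) (j : ι) (hj : j ∈ s) :
      choiceProb S j (update u a x) = choiceProb S j u := by
    rw [choiceProb, stable j (hmax j hj), update_of_ne (ne_of_mem_of_not_mem hj ha), choiceProb]
  have prob_update_self (x : V) :
      choiceProb S a (update u a x) = if x ∈ S a u then (#(S a u) : ℝ)⁻¹ else 0 := by
    rw [choiceProb, stable a le_rfl, update_self]
  calc ∑ x, ∏ j ∈ insert a s, choiceProb S j (update u a x)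
      = (∑ x, if x ∈ S a u then (#(S a u) : ℝ)⁻¹ else 0) * ∏ j ∈ s, choiceProb S j u := by
        rw [sum_mul]
        refine sum_congr rfl fun x _ => ?_
        rw [prod_insert ha, prob_update_self, prod_congr rfl (prob_update x)]
    _ ≤ ∏ j ∈ s, choiceProb S j u := by
        refine mul_le_of_le_one_left (prod_nonneg fun j _ => choiceProb_nonneg j u) ?_
        simpa using mul_inv_le_one

variable [Fintype ι] [Nonempty V]

theorem sum_prod_choiceProb_le_one
    (hS : ∀ j u u', (∀ i, r i < r j → u i = u' i) → S j u = S j u') :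
    ∑ u : ι → V, ∏ j, choiceProb S j u ≤ 1 := by
  have partial_choice (s : Finset ι) : (Fintype.card V : ℝ) ^ #s *
      ∑ u : ι → V, ∏ j ∈ s, choiceProb S j u ≤ (Fintype.card V : ℝ) ^ Fintype.card ι := by
    induction s using induction_on_max_value r with
    | empty => simp
    | insert a s ha hmax ih =>
      refine le_trans ?_ ih
      rw [card_insert_of_notMem ha, pow_succ, mul_assoc, ← sum_sum_update a]
      gcongr with u
      exact sum_prod_insert_choiceProb_le hS ha hmax u
  have hpos : (0 : ℝ) < (Fintype.card V : ℝ) ^ Fintype.card ι :=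
    pow_pos (by exact_mod_cast Fintype.card_pos) _
  exact le_of_mul_le_mul_left (by simpa using partial_choice univ) hpos

end SequentialChoice

theorem sum_one_add_sum_one_sub_card_div_le {ι α V : Type*} [Fintype ι] [LinearOrder α] [Finite V]
    [Nonempty V] {r : ι → α} {S : ι → (ι → V) → Finset V}
    (hS : ∀ j u u', (∀ i, r i < r j → u i = u' i) → S j u = S j u') {b : ι → ℝ}
    (hb : ∀ j, 0 < b j) (H : Finset (ι → V)) (hH : ∀ u ∈ H, ∀ j, u j ∈ S j u) :
    ∑ u ∈ H, (1 + ∑ j, (1 - #(S j u) / b j)) ≤ ∏ j, b j := by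
  classical
  have := Fintype.ofFinite V
  have le_prob (u) (hu : u ∈ H) :
      1 + ∑ j, (1 - #(S j u) / b j) ≤ (∏ j, b j) * ∏ j, choiceProb S j u := by
    have hcard (j : ι) : (0 : ℝ) < #(S j u) := by exact_mod_cast card_pos.2 ⟨_, hH u hu j⟩
    calc _ ≤ ∏ j, (#(S j u) / b j)⁻¹ :=
          one_add_sum_one_sub_le_prod_inv _ fun j _ => div_pos (hcard j) (hb j)
      _ = _ := by
          rw [← prod_mul_distrib]
          exact prod_congr rfl fun j _ => by
            rw [choiceProb, if_pos (hH u hu j), inv_div, div_eq_mul_inv]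
  calc _ ≤ ∑ u ∈ H, (∏ j, b j) * ∏ j, choiceProb S j u := sum_le_sum le_prob
    _ ≤ ∑ u, (∏ j, b j) * ∏ j, choiceProb S j u :=
        sum_le_sum_of_subset_of_nonneg (subset_univ _) fun u _ _ =>
          mul_nonneg (prod_nonneg fun j _ => (hb j).le) (prod_nonneg fun j _ =>
            choiceProb_nonneg j u)
    _ ≤ ∏ j, b j := by
        rw [← mul_sum]
        exact mul_le_of_le_one_right (prod_nonneg fun j _ => (hb j).le)
          (sum_prod_choiceProb_le_one hS)

section Residues

variable {k : ℕ}

theorem two_mul_natCast_ne_zero (hk : Odd k) {m : ℕ} (hm : 0 < m) (hmk : m < k) :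
    (2 * m : ZMod k) ≠ 0 := by
  intro h
  have hdvd : k ∣ 2 * m := (ZMod.natCast_eq_zero_iff _ _).1 (by exact_mod_cast h)
  exact Nat.not_dvd_of_pos_of_lt hm hmk (hk.coprime_two_right.dvd_of_dvd_mul_left hdvd)

variable [NeZero k]

theorem exists_natCast_of_odd_or (hk : Odd k) (x : ZMod k) :
    (∃ d : ℕ, Odd d ∧ d + 4 ≤ k ∧ (x = d ∨ x = -d)) ∨ x = 0 ∨ x = 2 ∨ x = -2 := by
  obtain ⟨v, hv, rfl⟩ : ∃ v < k, (v : ZMod k) = x := ⟨x.val, x.val_lt, ZMod.natCast_zmod_val x⟩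
  have neg_sub : ((k - v : ℕ) : ZMod k) = -v := by simp [Nat.cast_sub hv.le]
  rcases Nat.even_or_odd v with even_v | odd_v
  · obtain rfl | rfl | hv4 : v = 0 ∨ v = 2 ∨ 4 ≤ v := by grind
    · simp
    · simp
    · exact .inl ⟨k - v, Nat.Odd.sub_even hv.le hk even_v, by omega, .inr (by simp [neg_sub])⟩
  · by_cases hvk : v + 4 ≤ k
    · exact .inl ⟨v, odd_v, hvk, .inl rfl⟩
    · obtain rfl : k = v + 2 := by grind
      have : ((v + 2 : ℕ) : ZMod (v + 2)) = 0 := ZMod.natCast_self _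
      exact .inr (.inr (.inr (eq_neg_of_add_eq_zero_left (by exact_mod_cast this))))

theorem exists_natCast_of_even_or (hk : Odd k) (x : ZMod k) :
    (∃ d : ℕ, Even d ∧ d + 5 ≤ k ∧ (x = d ∨ x = -d)) ∨ x = 1 ∨ x = -1 ∨ x = 3 ∨ x = -3 := by
  obtain ⟨v, hv, rfl⟩ : ∃ v < k, (v : ZMod k) = x := ⟨x.val, x.val_lt, ZMod.natCast_zmod_val x⟩
  have neg_sub : ((k - v : ℕ) : ZMod k) = -v := by simp [Nat.cast_sub hv.le]
  rcases Nat.even_or_odd v with even_v | odd_v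
  · by_cases hvk : v + 5 ≤ k
    · exact .inl ⟨v, even_v, hvk, .inl rfl⟩
    · have cast_eq (w : ℕ) (hw : k = v + w) : (v : ZMod k) = -w := by
        rw [← neg_eq_iff_eq_neg, ← neg_sub, hw, Nat.add_sub_cancel_left]
      obtain h | h : k = v + 1 ∨ k = v + 3 := by grind
      · simp [cast_eq 1 h]
      · simp [cast_eq 3 h]
  · obtain rfl | rfl | hv5 : v = 1 ∨ v = 3 ∨ 5 ≤ v := by grind
    · simp
    · simp
    · exact .inl ⟨k - v, Nat.Odd.sub_odd hk odd_v, by omega, .inr (by simp [neg_sub])⟩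

end Residues

section CycleWeight

variable {k : ℕ}

/-- The weight with which the candidate sets of the sequential choice, averaged over the symmetries
of the cycle, count a vertex that is adjacent to the cycle exactly at `P` and has many common
neighbours with it exactly at `S`. -/
noncomputable def cycleWeight (P S : Finset (ZMod k)) : ℝ :=
  (2 * k - 9) * #P - (2 * k - 14) * #{i ∈ P | i + 2 ∈ P} +
    #{i ∈ S | i - 1 ∉ P} + #{i ∈ S | i + 1 ∉ P}

variable {P S : Finset (ZMod k)}

theorem cycleWeight_le_of_card_le (hk7 : 7 ≤ k) {p q s t : ℕ} (hp : #P ≤ p)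
    (hq : q ≤ #{i ∈ P | i + 2 ∈ P}) (hs : #{i ∈ S | i - 1 ∉ P} ≤ s)
    (ht : #{i ∈ S | i + 1 ∉ P} ≤ t) :
    cycleWeight P S ≤ (2 * k - 9) * p - (2 * k - 14) * q + s + t := by
  have h7 : (7 : ℝ) ≤ k := by exact_mod_cast hk7
  unfold cycleWeight
  gcongr <;> linarith

theorem cycleWeight_singleton_le (hk7 : 7 ≤ k) (a : ZMod k)
    (hS : ∀ b ∈ S, b = a + 1 ∨ b = a - 1 ∨ b = a + 3 ∨ b = a - 3) :
    cycleWeight {a} S ≤ 2 * (k : ℝ) - 2 := by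
  have left : {i ∈ S | i - 1 ∉ ({a} : Finset _)} ⊆ {a - 1, a + 3, a - 3} := by
    intro i hi
    obtain ⟨hiS, hia⟩ := mem_filter.1 hi
    rcases hS i hiS with rfl | rfl | rfl | rfl <;> simp_all
  have right : {i ∈ S | i + 1 ∉ ({a} : Finset _)} ⊆ {a + 1, a + 3, a - 3} := by
    intro i hi
    obtain ⟨hiS, hia⟩ := mem_filter.1 hi
    rcases hS i hiS with rfl | rfl | rfl | rfl <;> simp_all
  have h := cycleWeight_le_of_card_le hk7 (card_singleton a).le (Nat.zero_le _)
    ((card_le_card left).trans card_le_three) ((card_le_card right).trans card_le_three)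
  push_cast at h
  linarith

theorem cycleWeight_pair_le (hk7 : 7 ≤ k) (a : ZMod k)
    (hS : ∀ b ∈ S, b = a - 1 ∨ b = a + 1 ∨ b = a + 3) :
    cycleWeight {a, a + 2} S ≤ 2 * (k : ℝ) - 2 := by
  have left : {i ∈ S | i - 1 ∉ ({a, a + 2} : Finset _)} ⊆ {a - 1} := by
    intro i hi
    obtain ⟨hiS, hia⟩ := mem_filter.1 hi
    rcases hS i hiS with rfl | rfl | rfl <;> grind
  have right : {i ∈ S | i + 1 ∉ ({a, a + 2} : Finset _)} ⊆ {a + 3} := by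
    intro i hi
    obtain ⟨hiS, hia⟩ := mem_filter.1 hi
    rcases hS i hiS with rfl | rfl | rfl <;> grind
  have pair : 1 ≤ #{i ∈ ({a, a + 2} : Finset (ZMod k)) | i + 2 ∈ ({a, a + 2} : Finset (ZMod k))} :=
    card_pos.2 ⟨a, by simp⟩
  have h := cycleWeight_le_of_card_le hk7 card_le_two pair
    ((card_le_card left).trans_eq (card_singleton _))
    ((card_le_card right).trans_eq (card_singleton _))
  push_cast at h
  linarith

variable [NeZero k]

theorem cycleWeight_le (hk7 : 7 ≤ k) (P S : Finset (ZMod k)) :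
    cycleWeight P S ≤ 2 * (k : ℝ) ^ 2 := by
  have card_le (T : Finset (ZMod k)) : #T ≤ k := by simpa using card_le_univ T
  have h := cycleWeight_le_of_card_le hk7 (card_le P) (Nat.zero_le _)
    (card_le {i ∈ S | i - 1 ∉ P}) (card_le {i ∈ S | i + 1 ∉ P})
  push_cast at h
  nlinarith [(Nat.cast_nonneg k : (0 : ℝ) ≤ k)]

theorem cycleWeight_empty_le (hk7 : 7 ≤ k) (hS : ¬ (0 ∈ S ∧ 1 ∈ S)) :
    cycleWeight ∅ S ≤ 2 * (k : ℝ) - 2 := by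
  have hlt : #S < k := by
    simpa using (card_lt_univ_of_notMem (s := S) (x := if 0 ∈ S then 1 else 0) (by grind))
  have card_le (T : Finset (ZMod k)) (hT : T ⊆ S) : #T ≤ k - 1 :=
    (card_le_card hT).trans (by omega)
  have h := cycleWeight_le_of_card_le (P := ∅) (p := 0) hk7 (by simp) (Nat.zero_le _)
    (card_le _ (filter_subset (fun i => i - 1 ∉ ∅) S))
    (card_le _ (filter_subset (fun i => i + 1 ∉ ∅) S))
  rw [Nat.cast_sub (by omega)] at h
  push_cast at h
  linarith

theorem cycleWeight_le_of_sparse (hk : Odd k) (hk7 : 7 ≤ k)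
    (hPP : ∀ a ∈ P, ∀ b ∈ P, b - a = 0 ∨ b - a = 2 ∨ b - a = -2)
    (hPS : ∀ a ∈ P, ∀ b ∈ S, b - a = 1 ∨ b - a = -1 ∨ b - a = 3 ∨ b - a = -3)
    (hS : ¬ (0 ∈ S ∧ 1 ∈ S)) :
    cycleWeight P S ≤ 2 * (k : ℝ) - 2 := by
  have hne (m : ℕ) (hm : 0 < m := by norm_num) (hmk : m < 5 := by norm_num) :
      (2 * m : ZMod k) ≠ 0 := two_mul_natCast_ne_zero hk hm (by omega)
  have h2 := hne 1
  have h4 := hne 2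
  have h6 := hne 3
  have h8 := hne 4
  push_cast at h2 h4 h6 h8
  rcases P.eq_empty_or_nonempty with rfl | ⟨a₀, ha₀⟩
  · exact cycleWeight_empty_le hk7 hS
  by_cases hpair : ∃ a ∈ P, a + 2 ∈ P
  · obtain ⟨a, ha, ha2⟩ := hpair
    obtain rfl : P = {a, a + 2} := by
      ext b
      refine ⟨fun hb => ?_, by grind⟩
      have := hPP a ha b hb
      have := hPP _ ha2 b hb
      grind
    refine cycleWeight_pair_le hk7 a fun b hb => ?_
    have := hPS a ha b hb
    have := hPS _ ha2 b hb
    grind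
  · obtain rfl : P = {a₀} := by
      ext b
      refine ⟨fun hb => ?_, by grind⟩
      have := hPP a₀ ha₀ b hb
      grind
    refine cycleWeight_singleton_le hk7 a₀ fun b hb => ?_
    have := hPS a₀ ha₀ b hb
    grind

end CycleWeight

section SparseVertices

variable {V : Type*} [Fintype V] [DecidableEq V] (G : SimpleGraph V) [DecidableRel G.Adj]

theorem card_filter_le_adjMatrix_pow_mul_le {α β : ℝ} (hα : 0 ≤ α) (hβ : 0 ≤ β) (a b : ℕ)
    (u v : V) :
    #{z | α ≤ (G.adjMatrix ℝ ^ a) u z ∧ β ≤ (G.adjMatrix ℝ ^ b) v z} * (α * β)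
      ≤ (G.adjMatrix ℝ ^ (a + b)) u v := by
  rw [pow_add, Matrix.mul_apply, ← nsmul_eq_mul]
  refine (card_nsmul_le_sum _ (fun z => (G.adjMatrix ℝ ^ a) u z * (G.adjMatrix ℝ ^ b) z v) _
    fun z hz => ?_).trans <| sum_le_sum_of_subset_of_nonneg (subset_univ _) fun z _ _ =>
      mul_nonneg (adjMatrix_pow_nonneg G a u z) (adjMatrix_pow_nonneg G b z v)
  obtain ⟨-, hu, hv⟩ := mem_filter.1 hz
  rw [adjMatrix_pow_comm G b v z] at hv
  exact mul_le_mul hu hv hβ (hα.trans hu)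

variable {k : ℕ} [NeZero k]

/-- The indices of the vertices of `f` that are joined to `z` by at least `τ ^ r` walks of length
`r + 1`: the neighbours of `z` for `r = 0`, and the vertices having `τ` common neighbours with `z`
for `r = 1`. -/
noncomputable def nearIndices (τ : ℝ) (r : ℕ) (f : ZMod k → V) (z : V) : Finset (ZMod k) :=
  {i | τ ^ r ≤ (G.adjMatrix ℝ ^ (r + 1)) (f i) z}

variable {G} {τ : ℝ} {f : ZMod k → V} {z : V} {i : ZMod k}

theorem mem_nearIndices {r : ℕ} :
    i ∈ nearIndices G τ r f z ↔ τ ^ r ≤ (G.adjMatrix ℝ ^ (r + 1)) (f i) z := by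
  simp [nearIndices]

theorem mem_nearIndices_zero : i ∈ nearIndices G τ 0 f z ↔ G.Adj (f i) z := by
  rw [mem_nearIndices, pow_zero, zero_add, pow_one, adjMatrix_apply]
  split_ifs with h <;> simp [h]

theorem mem_nearIndices_one :
    i ∈ nearIndices G τ 1 f z ↔ τ ≤ (G.adjMatrix ℝ ^ 2) (f i) z := by
  rw [mem_nearIndices, pow_one]

theorem exists_mem_nearIndices_of_lt_cycleWeight (hk : Odd k) (hk7 : 7 ≤ k)
    (h : 2 * (k : ℝ) - 2 < cycleWeight (nearIndices G τ 0 f z) (nearIndices G τ 1 f z)) :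
    ∃ a < 2, ∃ b < 2, ∃ d < k, Odd (a + b + d) ∧ a + b + d + 4 ≤ k ∧
      ∃ i, i ∈ nearIndices G τ a f z ∧ i + d ∈ nearIndices G τ b f z := by
  contrapose! h
  refine cycleWeight_le_of_sparse hk hk7 (fun i hi j hj => ?_) (fun i hi j hj => ?_)
    fun ⟨h0, h1⟩ => ?_
  · refine (exists_natCast_of_odd_or hk (j - i)).resolve_left ?_
    rintro ⟨d, odd_d, hd, hx | hx⟩
    · refine h 0 (by simp) 0 (by simp) d (by omega) (by simpa) (by omega) i hi ?_
      rwa [← hx, add_sub_cancel]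
    · refine h 0 (by simp) 0 (by simp) d (by omega) (by simpa) (by omega) j hj ?_
      rwa [← neg_eq_iff_eq_neg.2 hx, neg_sub, add_sub_cancel]
  · refine (exists_natCast_of_even_or hk (j - i)).resolve_left ?_
    rintro ⟨d, even_d, hd, hx | hx⟩
    · refine h 0 (by simp) 1 (by simp) d (by omega) (by grind) (by omega) i hi ?_
      rwa [← hx, add_sub_cancel]
    · refine h 1 (by simp) 0 (by simp) d (by omega) (by grind) (by omega) j hj ?_
      rwa [← neg_eq_iff_eq_neg.2 hx, neg_sub, add_sub_cancel]
  · exact h 1 (by simp) 1 (by simp) 1 (by omega) (by decide) (by omega) 0 h0 (by simpa)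

variable {ε δ : ℝ}

theorem sum_cycleHoms_adjMatrix_pow_le {d r : ℕ} (hr : 1 ≤ r) (hd : d + 1 ≤ k)
    (h : (G.adjMatrix ℝ ^ (d + r)).trace ≤ ε * (Fintype.card V : ℝ) ^ (d + r)) (i : ZMod k) :
    ∑ f ∈ cycleHoms G k, (G.adjMatrix ℝ ^ r) (f i) (f (i + d))
      ≤ ε * (Fintype.card V : ℝ) ^ (k + r - 1) := by
  calc _ ≤ (Fintype.card V : ℝ) ^ (k - d - 1) * (G.adjMatrix ℝ ^ (d + r)).trace := by
        rw [trace_adjMatrix_pow_add]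
        exact sum_cycleHoms_le G hd i (adjMatrix_pow_nonneg G r)
    _ ≤ (Fintype.card V : ℝ) ^ (k - d - 1) * (ε * (Fintype.card V : ℝ) ^ (d + r)) := by gcongr
    _ = ε * (Fintype.card V : ℝ) ^ (k + r - 1) := by
        rw [mul_left_comm, ← pow_add]
        congr 2
        omega

theorem sum_card_mem_nearIndices_le [Nonempty V] (hε : 0 ≤ ε) (hδ : 0 < δ) (hδ1 : δ ≤ 1)
    {a b d : ℕ} (ha : a < 2) (hb : b < 2) (hd : d + 1 ≤ k)
    (h : (G.adjMatrix ℝ ^ (d + (a + b + 2))).trace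
      ≤ ε * (Fintype.card V : ℝ) ^ (d + (a + b + 2))) (i : ZMod k) :
    ∑ f ∈ cycleHoms G k, (#{z | i ∈ nearIndices G (δ * Fintype.card V) a f z ∧
        i + d ∈ nearIndices G (δ * Fintype.card V) b f z} : ℝ)
      ≤ ε / δ ^ 2 * (Fintype.card V : ℝ) ^ (k + 1) := by
  have hn : (0 : ℝ) < Fintype.card V := by exact_mod_cast Fintype.card_pos
  set n : ℝ := (Fintype.card V : ℝ)
  have sum_mul_le : (∑ f ∈ cycleHoms G k, (#{z | i ∈ nearIndices G (δ * n) a f z ∧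
      i + d ∈ nearIndices G (δ * n) b f z} : ℝ)) * (δ * n) ^ (a + b)
        ≤ ε * n ^ (k + 1 + (a + b)) := by
    rw [sum_mul, pow_add (δ * n)]
    calc _ ≤ ∑ f ∈ cycleHoms G k, (G.adjMatrix ℝ ^ (a + b + 2)) (f i) (f (i + d)) := by
          refine sum_le_sum fun f _ => ?_
          simp only [mem_nearIndices]
          rw [show a + b + 2 = a + 1 + (b + 1) by ring]
          exact card_filter_le_adjMatrix_pow_mul_le G (by positivity) (by positivity) _ _ _ _
      _ ≤ _ := by
          convert sum_cycleHoms_adjMatrix_pow_le (by omega) hd h i using 3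
          omega
  have pow_two_le : δ ^ 2 ≤ δ ^ (a + b) := pow_le_pow_of_le_one hδ.le hδ1 (by omega)
  calc _ ≤ ε * n ^ (k + 1 + (a + b)) / (δ * n) ^ (a + b) :=
        (le_div_iff₀ (by positivity)).2 sum_mul_le
    _ = ε / δ ^ (a + b) * n ^ (k + 1) := by field_simp; ring
    _ ≤ _ := by gcongr

theorem sum_card_lt_cycleWeight_le [Nonempty V] (hk : Odd k) (hk7 : 7 ≤ k) (hε : 0 ≤ ε)
    (hδ : 0 < δ) (hδ1 : δ ≤ 1)
    (h : ∀ l, Odd l → 3 ≤ l → l ≤ k - 2 →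
      (G.adjMatrix ℝ ^ l).trace ≤ ε * (Fintype.card V : ℝ) ^ l) :
    ∑ f ∈ cycleHoms G k, (#{z | 2 * (k : ℝ) - 2 < cycleWeight
        (nearIndices G (δ * Fintype.card V) 0 f z) (nearIndices G (δ * Fintype.card V) 1 f z)} : ℝ)
      ≤ 4 * k ^ 2 * (ε / δ ^ 2 * (Fintype.card V : ℝ) ^ (k + 1)) := by
  set n : ℝ := (Fintype.card V : ℝ)
  let T : Finset (ℕ × ℕ × ℕ × ZMod k) :=
    {x ∈ range 2 ×ˢ range 2 ×ˢ range k ×ˢ univ |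
      Odd (x.1 + x.2.1 + x.2.2.1) ∧ x.1 + x.2.1 + x.2.2.1 + 4 ≤ k}
  let Z (f : ZMod k → V) (x : ℕ × ℕ × ℕ × ZMod k) : Finset V :=
    {z | x.2.2.2 ∈ nearIndices G (δ * n) x.1 f z ∧
      x.2.2.2 + (x.2.2.1 : ZMod k) ∈ nearIndices G (δ * n) x.2.1 f z}
  have card_T : (#T : ℝ) ≤ 4 * k ^ 2 := by
    have : #T ≤ 2 * (2 * (k * k)) := (card_filter_le _ _).trans_eq (by simp)
    calc (#T : ℝ) ≤ 2 * (2 * (k * k)) := by exact_mod_cast this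
      _ = 4 * k ^ 2 := by ring
  have card_le (f : ZMod k → V) : (#{z | 2 * (k : ℝ) - 2 < cycleWeight
      (nearIndices G (δ * n) 0 f z) (nearIndices G (δ * n) 1 f z)} : ℝ)
        ≤ ∑ x ∈ T, (#(Z f x) : ℝ) := by
    have hsub : ({z | 2 * (k : ℝ) - 2 < cycleWeight (nearIndices G (δ * n) 0 f z)
        (nearIndices G (δ * n) 1 f z)} : Finset V) ⊆ T.biUnion (Z f) := fun z hz => by
      obtain ⟨a, ha, b, hb, d, hd, hodd, hle, i, hi, hid⟩ :=
        exists_mem_nearIndices_of_lt_cycleWeight hk hk7 (mem_filter.1 hz).2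
      exact mem_biUnion.2 ⟨(a, b, d, i), by simp [T, ha, hb, hd, hodd, hle], by simp [Z, hi, hid]⟩
    exact_mod_cast (card_le_card hsub).trans card_biUnion_le
  have sum_Z (x) (hx : x ∈ T) :
      ∑ f ∈ cycleHoms G k, (#(Z f x) : ℝ) ≤ ε / δ ^ 2 * n ^ (k + 1) := by
    simp only [T, mem_filter, mem_product, mem_range] at hx
    refine sum_card_mem_nearIndices_le hε hδ hδ1 hx.1.1 hx.1.2.1 (by omega)
      (h _ (by grind) (by grind) (by omega)) _
  calc _ ≤ ∑ f ∈ cycleHoms G k, ∑ x ∈ T, (#(Z f x) : ℝ) := sum_le_sum fun f _ => card_le f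
    _ = ∑ x ∈ T, ∑ f ∈ cycleHoms G k, (#(Z f x) : ℝ) := sum_comm
    _ ≤ #T • (ε / δ ^ 2 * n ^ (k + 1)) := sum_le_card_nsmul _ _ _ sum_Z
    _ ≤ _ := by rw [nsmul_eq_mul]; gcongr

end SparseVertices

section GoodCycleHoms

variable {V : Type*} [Fintype V] [DecidableEq V] (G : SimpleGraph V) [DecidableRel G.Adj] {k : ℕ}

/-- The candidates for the image of the vertex `t < k` of the cycle, when the images of the vertices
are chosen in the order `0, 1, 3, 2, 4, 5, …, k - 1`. -/
noncomputable def cycleCandidates (τ : ℝ) (t : ℕ) (f : ZMod k → V) : Finset V :=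
  match t with
  | 0 => univ
  | 1 => {z | G.Adj (f 0) z}
  | 2 => {z | G.Adj (f 1) z ∧ G.Adj (f 3) z}
  | 3 => {z | τ ≤ (G.adjMatrix ℝ ^ 2) (f 1) z ∧ ¬ G.Adj (f 0) z}
  | t + 4 =>
    if t + 5 = k then ({z | G.Adj (f (t + 3)) z ∧ G.Adj (f 0) z} : Finset V)
    else ({z | G.Adj (f (t + 3)) z ∧ ¬ G.Adj (f (t + 1)) z} : Finset V)

variable {G} {τ : ℝ}

theorem cycleCandidates_congr (hk : 5 ≤ k) {t : ℕ} (ht : t < k) {f g : ZMod k → V}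
    (h : ∀ s < k, Equiv.swap 2 3 s < Equiv.swap 2 3 t → f s = g s) :
    cycleCandidates G τ t f = cycleCandidates G τ t g := by
  have rank_add_four (m : ℕ) : Equiv.swap 2 3 (m + 4) = m + 4 :=
    Equiv.swap_apply_of_ne_of_ne (by omega) (by omega)
  have rank_le (m : ℕ) (hm : m < 4) : Equiv.swap 2 3 m < 4 := by decide +revert
  match t with
  | 0 => rfl
  | 1 =>
    have h0 : f 0 = g 0 := by exact_mod_cast h 0 (by omega) (by decide)
    simp only [cycleCandidates, h0]
  | 2 =>
    have h1 : f 1 = g 1 := by exact_mod_cast h 1 (by omega) (by decide)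
    have h3 : f 3 = g 3 := by exact_mod_cast h 3 (by omega) (by decide)
    simp only [cycleCandidates, h1, h3]
  | 3 =>
    have h0 : f 0 = g 0 := by exact_mod_cast h 0 (by omega) (by decide)
    have h1 : f 1 = g 1 := by exact_mod_cast h 1 (by omega) (by decide)
    simp only [cycleCandidates, h0, h1]
  | t + 4 =>
    have earlier (s : ℕ) (hs : s < t + 4) : f s = g s := by
      refine h s (by omega) ?_
      rw [rank_add_four]
      rcases lt_or_ge s 4 with hs4 | hs4
      · exact (rank_le s hs4).trans_le (by omega)
      · obtain ⟨m, rfl⟩ := Nat.exists_eq_add_of_le' hs4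
        rwa [rank_add_four]
    have h0 : f 0 = g 0 := by exact_mod_cast earlier 0 (by omega)
    have h1 : f (t + 1) = g (t + 1) := by exact_mod_cast earlier (t + 1) (by omega)
    have h3 : f (t + 3) = g (t + 3) := by exact_mod_cast earlier (t + 3) (by omega)
    simp only [cycleCandidates, h0, h1, h3]

variable [NeZero k] (G) (k) (τ)

/-- The homomorphisms of the cycle without chords between vertices at distance three, in which
vertices at distance two have at least `τ` common neighbours. All their values are candidates in the
sequential choice. -/
noncomputable def goodCycleHoms : Finset (ZMod k → V) :=
  {f ∈ cycleHoms G k | ∀ i, ¬ G.Adj (f i) (f (i + 3)) ∧ τ ≤ (G.adjMatrix ℝ ^ 2) (f i) (f (i + 2))}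

variable {G k τ} {f : ZMod k → V}

theorem comp_addRight_mem_goodCycleHoms (c : ZMod k) :
    f ∘ Equiv.addRight c ∈ goodCycleHoms G k τ ↔ f ∈ goodCycleHoms G k τ := by
  rw [goodCycleHoms, mem_filter, mem_filter, comp_addRight_mem_cycleHoms]
  refine and_congr_right fun _ => ?_
  rw [← (Equiv.addRight c).forall_congr_right (q := fun i => ¬ G.Adj (f i) (f (i + 3)) ∧
    τ ≤ (G.adjMatrix ℝ ^ 2) (f i) (f (i + 2)))]
  simp only [comp_apply, Equiv.coe_addRight, add_right_comm]

theorem comp_neg_mem_goodCycleHoms :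
    f ∘ Equiv.neg (ZMod k) ∈ goodCycleHoms G k τ ↔ f ∈ goodCycleHoms G k τ := by
  rw [goodCycleHoms, mem_filter, mem_filter, comp_neg_mem_cycleHoms, forall_and, forall_and]
  refine and_congr_right fun _ => and_congr ?_ ?_
  · rw [← (Equiv.subLeft (-3)).forall_congr_right]
    simp [G.adj_comm]
  · rw [← (Equiv.subLeft (-2)).forall_congr_right]
    simp [adjMatrix_pow_comm G 2 (f (_ + 2))]

theorem apply_mem_cycleCandidates (hf : f ∈ goodCycleHoms G k τ) (j : ZMod k) :
    f j ∈ cycleCandidates G τ j.val f := by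
  obtain ⟨hom, good⟩ := mem_filter.1 hf
  rw [mem_cycleHoms] at hom
  have natCast_val : ((j.val : ℕ) : ZMod k) = j := ZMod.natCast_zmod_val j
  generalize j.val = t at natCast_val
  subst natCast_val
  match t with
  | 0 => simp [cycleCandidates]
  | 1 => simpa [cycleCandidates] using hom 0
  | 2 =>
    have h12 : G.Adj (f 1) (f 2) := by convert hom 1 using 2; norm_num
    have h32 : G.Adj (f 3) (f 2) := by convert (hom 2).symm using 2; norm_num
    simp [cycleCandidates, h12, h32]
  | 3 =>
    have h03 : ¬ G.Adj (f 0) (f 3) := by simpa using (good 0).1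
    have h13 : τ ≤ (G.adjMatrix ℝ ^ 2) (f 1) (f 3) := by convert (good 1).2 using 3; norm_num
    simp [cycleCandidates, h03, h13]
  | t + 4 =>
    have h34 : G.Adj (f (t + 3)) (f (t + 4)) := by
      convert hom (t + 3) using 2; ring
    have h14 : ¬ G.Adj (f (t + 1)) (f (t + 4)) := by
      convert (good (t + 1)).1 using 3; ring
    by_cases htk : t + 5 = k
    · have h04 : G.Adj (f 0) (f (t + 4)) := by
        have : (t + 4 + 1 : ZMod k) = 0 := by
          rw [← ZMod.natCast_self k, ← htk]; push_cast; ring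
        simpa only [this] using (hom (t + 4)).symm
      simp [cycleCandidates, htk, h34, h04]
    · simp [cycleCandidates, htk, h34, h14]

end GoodCycleHoms

section Averaging

@[to_additive]
theorem prod_comp_zmodVal {M : Type*} [CommMonoid M] (k : ℕ) [NeZero k] (F : ℕ → M) :
    ∏ j : ZMod k, F j.val = ∏ t ∈ range k, F t :=
  prod_nbij ZMod.val (fun j _ => mem_range.2 j.val_lt) ((ZMod.val_injective k).injOn)
    (fun t ht => ⟨t, mem_coe.2 (mem_univ _), ZMod.val_cast_of_lt (mem_range.1 ht)⟩) fun _ _ => rfl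

/-- The numbers of candidates for the vertex `t` of the cycle of length `k` if all choices are made
in the blow-up of this cycle with parts of size `x`. -/
def blowupSize (k : ℕ) (x : ℝ) : ℕ → ℝ
  | 0 => k * x
  | 1 => 2 * x
  | _ + 2 => x

theorem blowupSize_pos {k : ℕ} (hk : 0 < k) {x : ℝ} (hx : 0 < x) (t : ℕ) :
    0 < blowupSize k x t := by
  match t with
  | 0 | 1 | t + 2 => simp only [blowupSize]; positivity

theorem prod_blowupSize {k : ℕ} (hk : 2 ≤ k) (x : ℝ) :
    ∏ t ∈ range k, blowupSize k x t = 2 * k * x ^ k := by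
  obtain ⟨m, rfl⟩ := Nat.exists_eq_add_of_le' hk
  rw [prod_range_succ', prod_range_succ', prod_congr rfl fun t _ => rfl]
  simp only [blowupSize, prod_const, card_range]
  ring

variable {V : Type*} [Fintype V] [DecidableEq V] (G : SimpleGraph V) [DecidableRel G.Adj] (k : ℕ)
  [NeZero k] (τ : ℝ)

/-- The number of pairs of a good homomorphism and a neighbour of one fixed vertex of its image. By
rotation it does not matter which one. -/
noncomputable def degreeTotal : ℝ :=
  ∑ f ∈ goodCycleHoms G k τ, (#{z | G.Adj (f 0) z} : ℝ)

/-- The number of pairs of a good homomorphism and a common neighbour of two fixed vertices of its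
image at distance two. -/
noncomputable def codegreeTotal : ℝ :=
  ∑ f ∈ goodCycleHoms G k τ, (#{z | G.Adj (f 0) z ∧ G.Adj (f 2) z} : ℝ)

/-- The number of pairs of a good homomorphism and a vertex having `τ` common neighbours with one
fixed vertex of its image, but not adjacent to a fixed neighbour of that vertex in the cycle. -/
noncomputable def secondDegreeTotal : ℝ :=
  ∑ f ∈ goodCycleHoms G k τ, (#{z | τ ≤ (G.adjMatrix ℝ ^ 2) (f 1) z ∧ ¬ G.Adj (f 0) z} : ℝ)

variable {G k τ}

theorem sum_goodCycleHoms_apply_add (F : V → V → ℝ) (a b c : ZMod k) :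
    ∑ f ∈ goodCycleHoms G k τ, F (f (a + c)) (f (b + c))
      = ∑ f ∈ goodCycleHoms G k τ, F (f a) (f b) :=
  sum_comp_equiv_of_mem _ (Equiv.addRight c) (fun _ => comp_addRight_mem_goodCycleHoms c)
    fun f => F (f a) (f b)

theorem sum_goodCycleHoms_apply_neg (F : V → V → ℝ) (a b : ZMod k) :
    ∑ f ∈ goodCycleHoms G k τ, F (f (-a)) (f (-b))
      = ∑ f ∈ goodCycleHoms G k τ, F (f a) (f b) :=
  sum_comp_equiv_of_mem _ (Equiv.neg _) (fun _ => comp_neg_mem_goodCycleHoms)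
    fun f => F (f a) (f b)

theorem sum_card_adj (i : ZMod k) :
    ∑ f ∈ goodCycleHoms G k τ, (#{z | G.Adj (f i) z} : ℝ) = degreeTotal G k τ := by
  simpa [degreeTotal] using
    sum_goodCycleHoms_apply_add (fun u _ => (#{z | G.Adj u z} : ℝ)) 0 0 i

theorem sum_card_adj_and_adj (i : ZMod k) :
    ∑ f ∈ goodCycleHoms G k τ, (#{z | G.Adj (f i) z ∧ G.Adj (f (i + 2)) z} : ℝ)
      = codegreeTotal G k τ := by
  simpa [codegreeTotal, add_comm] using
    sum_goodCycleHoms_apply_add (fun u v => (#{z | G.Adj u z ∧ G.Adj v z} : ℝ)) 0 2 i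

theorem sum_card_adj_and_not_adj (i : ZMod k) :
    ∑ f ∈ goodCycleHoms G k τ, (#{z | G.Adj (f (i + 2)) z ∧ ¬ G.Adj (f i) z} : ℝ)
      = degreeTotal G k τ - codegreeTotal G k τ := by
  rw [← sum_card_adj (i + 2), ← sum_card_adj_and_adj i, ← sum_sub_distrib]
  refine sum_congr rfl fun f _ => eq_sub_of_add_eq' ?_
  simp_rw [and_comm (a := G.Adj (f i) _), ← filter_filter]
  exact_mod_cast card_filter_add_card_filter_not _

theorem sum_card_le_and_not_adj_sub_one (i : ZMod k) :
    ∑ f ∈ goodCycleHoms G k τ,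
      (#{z | τ ≤ (G.adjMatrix ℝ ^ 2) (f i) z ∧ ¬ G.Adj (f (i - 1)) z} : ℝ)
      = secondDegreeTotal G k τ := by
  have h := sum_goodCycleHoms_apply_add (G := G) (τ := τ)
    (fun u v => (#{z | τ ≤ (G.adjMatrix ℝ ^ 2) u z ∧ ¬ G.Adj v z} : ℝ)) 1 0 (i - 1)
  rwa [add_sub_cancel, zero_add] at h

theorem sum_card_le_and_not_adj_add_one (i : ZMod k) :
    ∑ f ∈ goodCycleHoms G k τ,
      (#{z | τ ≤ (G.adjMatrix ℝ ^ 2) (f i) z ∧ ¬ G.Adj (f (i + 1)) z} : ℝ)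
      = secondDegreeTotal G k τ := by
  have h := sum_goodCycleHoms_apply_neg (G := G) (τ := τ)
    (fun u v => (#{z | τ ≤ (G.adjMatrix ℝ ^ 2) u z ∧ ¬ G.Adj v z} : ℝ)) (-i) (-i - 1)
  rwa [sum_card_le_and_not_adj_sub_one, neg_neg, neg_sub, sub_neg_eq_add, add_comm 1] at h

theorem sum_cycleWeight_nearIndices (f : ZMod k → V) :
    ∑ z, cycleWeight (nearIndices G τ 0 f z) (nearIndices G τ 1 f z) =
      ∑ i, ((2 * k - 9) * (#{z | G.Adj (f i) z} : ℝ)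
        - (2 * k - 14) * (#{z | G.Adj (f i) z ∧ G.Adj (f (i + 2)) z} : ℝ)
        + #{z | τ ≤ (G.adjMatrix ℝ ^ 2) (f i) z ∧ ¬ G.Adj (f (i - 1)) z}
        + #{z | τ ≤ (G.adjMatrix ℝ ^ 2) (f i) z ∧ ¬ G.Adj (f (i + 1)) z}) := by
  have double_count (R : V → ZMod k → Prop) [∀ z i, Decidable (R z i)] (T : V → Finset (ZMod k))
      (hT : ∀ z i, i ∈ T z ↔ R z i) : ∑ z, (#(T z) : ℝ) = ∑ i, (#{z | R z i} : ℝ) := by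
    have (z : V) : T z = ({i | R z i} : Finset (ZMod k)) := by ext; simp [hT]
    simp_rw [this]
    exact_mod_cast sum_card_bipartiteAbove_eq_sum_card_bipartiteBelow R
  simp only [cycleWeight, sum_add_distrib, sum_sub_distrib, ← mul_sum]
  rw [double_count (fun z i => G.Adj (f i) z) _ fun _ _ => mem_nearIndices_zero,
    double_count (fun z i => G.Adj (f i) z ∧ G.Adj (f (i + 2)) z) _ fun _ _ => ?_,
    double_count (fun z i => τ ≤ (G.adjMatrix ℝ ^ 2) (f i) z ∧ ¬ G.Adj (f (i - 1)) z) _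
      fun _ _ => ?_,
    double_count (fun z i => τ ≤ (G.adjMatrix ℝ ^ 2) (f i) z ∧ ¬ G.Adj (f (i + 1)) z) _
      fun _ _ => ?_]
  all_goals simp only [mem_filter, mem_nearIndices_zero, mem_nearIndices_one]

theorem sum_sum_cycleWeight :
    ∑ f ∈ goodCycleHoms G k τ, ∑ z, cycleWeight (nearIndices G τ 0 f z) (nearIndices G τ 1 f z)
      = k * ((2 * k - 9) * degreeTotal G k τ - (2 * k - 14) * codegreeTotal G k τ
          + 2 * secondDegreeTotal G k τ) := by
  simp_rw [sum_cycleWeight_nearIndices]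
  rw [sum_comm]
  simp only [sum_add_distrib, sum_sub_distrib, ← mul_sum, sum_card_adj, sum_card_adj_and_adj,
    sum_card_le_and_not_adj_sub_one, sum_card_le_and_not_adj_add_one, sum_const, card_univ,
    ZMod.card, nsmul_eq_mul]
  ring

theorem sum_card_cycleCandidates_add_four {t : ℕ} (ht : t + 5 ≠ k) :
    ∑ f ∈ goodCycleHoms G k τ, (#(cycleCandidates G τ (t + 4) f) : ℝ)
      = degreeTotal G k τ - codegreeTotal G k τ := by
  have h : (t : ZMod k) + 1 + 2 = t + 3 := by ring
  rw [← sum_card_adj_and_not_adj ((t : ZMod k) + 1), h]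
  simp only [cycleCandidates, ht, if_false]

theorem sum_card_cycleCandidates_of_add_five_eq {t : ℕ} (ht : t + 5 = k) :
    ∑ f ∈ goodCycleHoms G k τ, (#(cycleCandidates G τ (t + 4) f) : ℝ) = codegreeTotal G k τ := by
  have h : (t : ZMod k) + 3 + 2 = 0 := by
    rw [← ZMod.natCast_self k, ← ht]; push_cast; ring
  rw [← sum_card_adj_and_adj ((t : ZMod k) + 3), h]
  simp only [cycleCandidates, ht, if_true]

theorem sum_range_add_five (F : ℕ → ℝ) (m : ℕ) :
    ∑ t ∈ range (m + 5), F t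
      = F 0 + F 1 + F 2 + F 3 + ∑ t ∈ range m, F (t + 4) + F (m + 4) := by
  rw [sum_range_succ, sum_range_succ', sum_range_succ', sum_range_succ', sum_range_succ']
  ring

theorem sum_sum_card_cycleCandidates_div [Nonempty V] (hk : 5 ≤ k) :
    ∑ f ∈ goodCycleHoms G k τ, ∑ j : ZMod k,
        #(cycleCandidates G τ j.val f) / blowupSize k (Fintype.card V / k) j.val
      = #(goodCycleHoms G k τ) + (∑ f ∈ goodCycleHoms G k τ, ∑ z,
          cycleWeight (nearIndices G τ 0 f z) (nearIndices G τ 1 f z)) / (2 * Fintype.card V) := by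
  have hn : (Fintype.card V : ℝ) ≠ 0 := by exact_mod_cast Fintype.card_ne_zero
  obtain ⟨m, hm⟩ := Nat.exists_eq_add_of_le' hk
  have cast_k : (k : ℝ) = m + 5 := by rw [hm]; push_cast; rfl
  have hk0 : (m : ℝ) + 5 ≠ 0 := by positivity
  have at_zero : ∑ f ∈ goodCycleHoms G k τ, (#(cycleCandidates G τ 0 f) : ℝ)
      = #(goodCycleHoms G k τ) * Fintype.card V := by
    simp only [cycleCandidates, card_univ, sum_const, nsmul_eq_mul]
  have at_one : ∑ f ∈ goodCycleHoms G k τ, (#(cycleCandidates G τ 1 f) : ℝ)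
      = degreeTotal G k τ := rfl
  have at_two : ∑ f ∈ goodCycleHoms G k τ, (#(cycleCandidates G τ 2 f) : ℝ)
      = codegreeTotal G k τ := by
    have h : (1 : ZMod k) + 2 = 3 := by norm_num
    simp only [cycleCandidates, ← sum_card_adj_and_adj 1, h]
  have at_three : ∑ f ∈ goodCycleHoms G k τ, (#(cycleCandidates G τ 3 f) : ℝ)
      = secondDegreeTotal G k τ := rfl
  have at_middle : ∀ t ∈ range m, ∑ f ∈ goodCycleHoms G k τ,
      (#(cycleCandidates G τ (t + 4) f) : ℝ) = degreeTotal G k τ - codegreeTotal G k τ :=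
    fun t ht => sum_card_cycleCandidates_add_four (by rw [mem_range] at ht; omega)
  rw [sum_comm]
  simp_rw [← sum_div]
  rw [sum_comp_zmodVal k fun t => (∑ f ∈ goodCycleHoms G k τ, (#(cycleCandidates G τ t f) : ℝ)) /
      blowupSize k (Fintype.card V / k) t, congrArg range hm, sum_range_add_five, at_zero, at_one,
    at_two, at_three, sum_congr rfl fun t ht => by rw [at_middle t ht],
    sum_card_cycleCandidates_of_add_five_eq hm.symm, sum_sum_cycleWeight]
  simp only [blowupSize, sum_const, card_range, nsmul_eq_mul, cast_k]
  field_simp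
  ring

end Averaging

section GoodCycleHomsBound

variable {V : Type*} [Fintype V] [DecidableEq V] {G : SimpleGraph V} [DecidableRel G.Adj] {k : ℕ}
  [NeZero k] {τ : ℝ}

theorem sum_cycleWeight_nearIndices_le (hk7 : 7 ≤ k) (f : ZMod k → V) :
    ∑ z, cycleWeight (nearIndices G τ 0 f z) (nearIndices G τ 1 f z)
      ≤ Fintype.card V * (2 * k - 2) + 2 * (k : ℝ) ^ 2 * #{z | 2 * (k : ℝ) - 2 <
        cycleWeight (nearIndices G τ 0 f z) (nearIndices G τ 1 f z)} := by
  have hk1 : (7 : ℝ) ≤ k := by exact_mod_cast hk7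
  calc _ ≤ ∑ z, ((2 * (k : ℝ) - 2) + 2 * (k : ℝ) ^ 2 * if 2 * (k : ℝ) - 2 <
          cycleWeight (nearIndices G τ 0 f z) (nearIndices G τ 1 f z) then 1 else 0) := by
        gcongr with z
        have := cycleWeight_le hk7 (nearIndices G τ 0 f z) (nearIndices G τ 1 f z)
        split_ifs <;> linarith
    _ = _ := by
        rw [sum_add_distrib, ← mul_sum, sum_boole, sum_const, card_univ, nsmul_eq_mul]

theorem card_goodCycleHoms_le [Nonempty V] (hk7 : 7 ≤ k) :
    (#(goodCycleHoms G k τ) : ℝ) ≤ 2 * k * (Fintype.card V / k : ℝ) ^ k +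
      k ^ 2 / Fintype.card V * ∑ f ∈ goodCycleHoms G k τ, (#{z | 2 * (k : ℝ) - 2 <
        cycleWeight (nearIndices G τ 0 f z) (nearIndices G τ 1 f z)} : ℝ) := by
  have hn : (0 : ℝ) < Fintype.card V := by exact_mod_cast Fintype.card_pos
  have hk : (0 : ℝ) < k := by exact_mod_cast (by omega : 0 < k)
  have choices := sum_one_add_sum_one_sub_card_div_le
    (S := fun (j : ZMod k) u => cycleCandidates G τ j.val u)
    (r := fun j => Equiv.swap 2 3 j.val) (b := fun j => blowupSize k (Fintype.card V / k) j.val)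
    (fun j u u' huu' => cycleCandidates_congr (by omega) j.val_lt fun s hs hsj =>
      huu' s (by rwa [ZMod.val_cast_of_lt hs]))
    (fun j => blowupSize_pos (by omega) (div_pos hn hk) j.val)
    (goodCycleHoms G k τ) fun u hu j => apply_mem_cycleCandidates hu j
  simp only [sum_add_distrib, sum_sub_distrib, sum_const, card_univ, ZMod.card, nsmul_eq_mul,
    mul_one, prod_comp_zmodVal k (blowupSize k (Fintype.card V / k)),
    prod_blowupSize (by omega : 2 ≤ k)] at choices
  rw [sum_sum_card_cycleCandidates_div (by omega)] at choices
  have weights := sum_le_sum fun f (_ : f ∈ goodCycleHoms G k τ) =>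
    sum_cycleWeight_nearIndices_le (G := G) (τ := τ) hk7 f
  rw [sum_add_distrib, sum_const, ← mul_sum, nsmul_eq_mul] at weights
  have average := div_le_div_of_nonneg_right weights (by positivity : 0 ≤ 2 * (Fintype.card V : ℝ))
  field_simp at average choices ⊢
  linarith

end GoodCycleHomsBound

section CycleHomsBound

variable {V : Type*} [Fintype V] [DecidableEq V] {G : SimpleGraph V} [DecidableRel G.Adj] {k : ℕ}
  [NeZero k] {ε τ δ : ℝ}

theorem card_cycleHoms_adj_add_three_le (hk : 4 ≤ k)
    (h : (G.adjMatrix ℝ ^ (k - 2)).trace ≤ ε * (Fintype.card V : ℝ) ^ (k - 2)) (i : ZMod k) :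
    (#{f ∈ cycleHoms G k | G.Adj (f i) (f (i + 3))} : ℝ) ≤ ε * (Fintype.card V : ℝ) ^ k := by
  have hk3 : k - 2 = k - 3 + 1 := by omega
  have around : i + 3 + ((k - 3 : ℕ) : ZMod k) = i := by
    rw [Nat.cast_sub (by omega), ZMod.natCast_self]; push_cast; ring
  rw [hk3] at h
  have closed := sum_cycleHoms_adjMatrix_pow_le le_rfl (by omega) h (i + 3)
  rw [Nat.add_sub_cancel, around] at closed
  simpa only [pow_one, adjMatrix_apply, G.adj_comm, sum_boole] using closed

theorem card_cycleHoms_codegree_lt_le (hk : 3 ≤ k) (hτ : 0 ≤ τ) (i : ZMod k) :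
    (#{f ∈ cycleHoms G k | (G.adjMatrix ℝ ^ 2) (f i) (f (i + 2)) < τ} : ℝ)
      ≤ τ * (Fintype.card V : ℝ) ^ (k - 1) := by
  calc _ = ∑ f ∈ cycleHoms G k,
          if (G.adjMatrix ℝ ^ 2) (f i) (f (i + (2 : ℕ))) < τ then (1 : ℝ) else 0 := by
        rw [sum_boole, Nat.cast_ofNat]
    _ ≤ (Fintype.card V : ℝ) ^ (k - 2 - 1) * ∑ u, ∑ v, (G.adjMatrix ℝ ^ 2) u v *
          if (G.adjMatrix ℝ ^ 2) u v < τ then 1 else 0 :=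
        sum_cycleHoms_le G (M := fun u v => if (G.adjMatrix ℝ ^ 2) u v < τ then 1 else 0)
          (by omega) i fun u v => by positivity
    _ ≤ (Fintype.card V : ℝ) ^ (k - 2 - 1) * ∑ _u : V, ∑ _v : V, τ := by
        gcongr with u _ v _
        split_ifs with hlt
        · rw [mul_one]; exact hlt.le
        · rwa [mul_zero]
    _ = τ * (Fintype.card V : ℝ) ^ (k - 2 - 1 + 2) := by
        simp only [sum_const, card_univ, nsmul_eq_mul]; ring
    _ = _ := by congr 2; omega

theorem card_cycleHoms_le_card_goodCycleHoms_add (hk : 4 ≤ k) (hτ : 0 ≤ τ)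
    (h : (G.adjMatrix ℝ ^ (k - 2)).trace ≤ ε * (Fintype.card V : ℝ) ^ (k - 2)) :
    (#(cycleHoms G k) : ℝ) ≤ #(goodCycleHoms G k τ) + k * (ε * (Fintype.card V : ℝ) ^ k)
      + k * (τ * (Fintype.card V : ℝ) ^ (k - 1)) := by
  let chords (i : ZMod k) := {f ∈ cycleHoms G k | G.Adj (f i) (f (i + 3))}
  let rare (i : ZMod k) := {f ∈ cycleHoms G k | (G.adjMatrix ℝ ^ 2) (f i) (f (i + 2)) < τ}
  have hsub : cycleHoms G k ⊆ goodCycleHoms G k τ ∪ univ.biUnion chords ∪ univ.biUnion rare := by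
    intro f hf
    by_contra hne
    simp only [chords, rare, goodCycleHoms, mem_union, mem_biUnion, mem_univ, true_and,
      mem_filter, hf, not_or, not_exists, not_lt] at hne
    exact hne.1.1 fun i => ⟨hne.1.2 i, hne.2 i⟩
  have hcard := (card_le_card hsub).trans <| (card_union_le _ _).trans <|
    add_le_add ((card_union_le _ _).trans (add_le_add_right card_biUnion_le _)) card_biUnion_le
  have sum_const_zmod (x : ℝ) : ∑ _i : ZMod k, x = k * x := by simp
  calc (#(cycleHoms G k) : ℝ)
      ≤ #(goodCycleHoms G k τ) + ∑ i, (#(chords i) : ℝ) + ∑ i, (#(rare i) : ℝ) := by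
        exact_mod_cast hcard
    _ ≤ _ := by
        simp_rw [← sum_const_zmod]
        gcongr with i _ i _
        · exact card_cycleHoms_adj_add_three_le hk h i
        · exact card_cycleHoms_codegree_lt_le (by omega) hτ i

theorem card_cycleHoms_le [Nonempty V] (hk : Odd k) (hk7 : 7 ≤ k) (hε : 0 ≤ ε) (hδ : 0 < δ)
    (hδ1 : δ ≤ 1)
    (h : ∀ l, Odd l → 3 ≤ l → l ≤ k - 2 →
      (G.adjMatrix ℝ ^ l).trace ≤ ε * (Fintype.card V : ℝ) ^ l) :
    (#(cycleHoms G k) : ℝ) ≤ 2 * k * (Fintype.card V / k : ℝ) ^ k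
      + (4 * k ^ 4 * (ε / δ ^ 2) + k * ε + k * δ) * (Fintype.card V : ℝ) ^ k := by
  have : (0 : ℝ) < Fintype.card V := by exact_mod_cast Fintype.card_pos
  have all_le := card_cycleHoms_le_card_goodCycleHoms_add (τ := δ * Fintype.card V) (by omega)
    (by positivity) (h (k - 2) (Nat.Odd.sub_even (by omega) hk even_two) (by omega) le_rfl)
  have good_le := card_goodCycleHoms_le (G := G) (τ := δ * Fintype.card V) hk7
  have heavy_le : (k : ℝ) ^ 2 / Fintype.card V * ∑ f ∈ goodCycleHoms G k (δ * Fintype.card V),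
      (#{z | 2 * (k : ℝ) - 2 < cycleWeight (nearIndices G (δ * Fintype.card V) 0 f z)
        (nearIndices G (δ * Fintype.card V) 1 f z)} : ℝ)
      ≤ k ^ 2 / Fintype.card V * (4 * k ^ 2 * (ε / δ ^ 2 * (Fintype.card V : ℝ) ^ (k + 1))) := by
    gcongr
    exact (sum_le_sum_of_subset_of_nonneg (filter_subset _ _) fun _ _ _ => by positivity).trans
      (sum_card_lt_cycleWeight_le hk hk7 hε hδ hδ1 h)
  have heavy_eq : (k : ℝ) ^ 2 / Fintype.card V *
      (4 * k ^ 2 * (ε / δ ^ 2 * (Fintype.card V : ℝ) ^ (k + 1)))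
      = 4 * k ^ 4 * (ε / δ ^ 2) * (Fintype.card V : ℝ) ^ k := by
    field_simp
    ring
  rw [mul_assoc δ, ← pow_succ', Nat.sub_add_cancel (by omega)] at all_le
  linarith

end CycleHomsBound

section Copies

variable {V W : Type*}

theorem toSubgraph_comp_toCopy {T : SimpleGraph W} {G : SimpleGraph V} (f : Copy T G)
    (σ : T ≃g T) : (f.comp σ.toCopy).toSubgraph = f.toSubgraph := by
  have map_top : (⊤ : T.Subgraph).map σ.toCopy.toHom = ⊤ := by
    ext <;> simp
  have : f.toSubgraph = ((⊤ : T.Subgraph).map σ.toCopy.toHom).map f.toHom := by rw [map_top]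
  rw [this, ← Subgraph.map_comp]
  rfl

variable [Fintype V] [Fintype W]

theorem labelledCopyCount_le_card_of_forall_mem {T : SimpleGraph W} {G : SimpleGraph V}
    {s : Finset (W → V)} (hs : ∀ f : Copy T G, ⇑f ∈ s) :
    G.labelledCopyCount T ≤ #s := by
  classical
  rw [labelledCopyCount, ← card_univ]
  exact card_le_card_of_injOn (⇑) (fun f _ => hs f) DFunLike.coe_injective.injOn

theorem card_iso_mul_copyCount_le (T : SimpleGraph W) (G : SimpleGraph V) :
    Nat.card (T ≃g T) * G.copyCount T ≤ G.labelledCopyCount T := by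
  classical
  have : Fintype (T ≃g T) := Fintype.ofInjective _ RelIso.toEquiv_injective
  rw [copyCount_eq_card_image_copyToSubgraph, labelledCopyCount, ← card_univ,
    Nat.card_eq_fintype_card, ← card_univ]
  refine mul_card_image_le_card _ _ fun S hS => ?_
  obtain ⟨f, -, rfl⟩ := mem_image.1 hS
  refine card_le_card_of_injOn (fun σ => f.comp σ.toCopy)
    (fun σ _ => by simp [toSubgraph_comp_toCopy]) fun σ _ σ' _ h => ?_
  ext w
  exact f.injective (DFunLike.congr_fun h w)

theorem prod_card_fiber_le_copyCount_comap [DecidableEq W] (T : SimpleGraph W) (c : V → W) :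
    ∏ w, #{v | c v = w} ≤ (T.comap c).copyCount T := by
  classical
  have section_eq {u : W → V} (hu : u ∈ Fintype.piFinset fun w => ({v | c v = w} : Finset V)) (w) :
      c (u w) = w := by simpa using Fintype.mem_piFinset.1 hu w
  let copy (u : W → V) (hu : ∀ w, c (u w) = w) : Copy T (T.comap c) :=
    ⟨⟨u, fun h => by simpa [hu] using h⟩, LeftInverse.injective hu⟩
  rw [← Fintype.card_piFinset, copyCount]
  refine card_le_card_of_forall_subsingleton (fun u S => S.verts = Set.range u) (fun u hu => ?_) ?_
  · refine ⟨(copy u (section_eq hu)).toSubgraph, ?_, ?_⟩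
    · simpa using ⟨(copy u (section_eq hu)).isoToSubgraph⟩
    · simp [copy]
  · rintro S - u ⟨hu, hSu⟩ u' ⟨hu', hSu'⟩
    ext w
    obtain ⟨w', hw'⟩ : u w ∈ Set.range u' := hSu' ▸ hSu ▸ Set.mem_range_self w
    rw [← hw', ← section_eq hu' w', hw', section_eq hu w]

end Copies

section Cycles

theorem cycleGraph_succ_adj {m : ℕ} {u v : Fin (m + 1)} :
    (cycleGraph (m + 1)).Adj u v ↔ u ≠ v ∧ (u = v + 1 ∨ v = u + 1) := by
  rw [cycleGraph_eq_circulantGraph, circulantGraph_adj]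
  simp [sub_eq_iff_eq_add']

theorem two_mul_le_card_cycleGraph_iso {k : ℕ} (hk : 3 ≤ k) :
    2 * k ≤ Nat.card (cycleGraph k ≃g cycleGraph k) := by
  obtain ⟨m, rfl⟩ := Nat.exists_eq_add_of_le' hk
  have : Finite (cycleGraph (m + 3) ≃g cycleGraph (m + 3)) :=
    Finite.of_injective _ RelIso.toEquiv_injective
  let rotation (c : Fin (m + 3)) : cycleGraph (m + 3) ≃g cycleGraph (m + 3) :=
    ⟨Equiv.addLeft c, by simp [cycleGraph_succ_adj, add_assoc]⟩
  let reflection (c : Fin (m + 3)) : cycleGraph (m + 3) ≃g cycleGraph (m + 3) :=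
    ⟨Equiv.subLeft c, fun {a b} => by
      have shift (x y : Fin (m + 3)) : c - x = c - y + 1 ↔ y = x + 1 := by
        rw [sub_add, sub_right_inj, eq_sub_iff_add_eq, eq_comm]
      simp [cycleGraph_succ_adj, shift, or_comm]⟩
  have rotation_ne_reflection (c d : Fin (m + 3)) : rotation c ≠ reflection d := fun h => by
    have h0 : c + 0 = d - 0 := DFunLike.congr_fun h 0
    have h1 : c + 1 = d - 1 := DFunLike.congr_fun h 1
    have two_eq_zero : (2 : Fin (m + 3)) = 0 := by
      rw [add_zero, sub_zero] at h0
      rw [h0, eq_sub_iff_add_eq, add_assoc, add_eq_left] at h1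
      exact h1
    rw [Fin.ext_iff, Fin.val_two] at two_eq_zero
    exact two_ne_zero two_eq_zero
  have rotation_injective : Injective rotation := fun c d h => by
    simpa [rotation] using DFunLike.congr_fun h 0
  have reflection_injective : Injective reflection := fun c d h => by
    simpa [reflection] using DFunLike.congr_fun h 0
  have := Nat.card_le_card_of_injective _
    (rotation_injective.sumElim reflection_injective rotation_ne_reflection)
  simpa [two_mul] using this

theorem isEmpty_cycleGraph_hom {m k : ℕ} (hm : Odd m) (hm2 : 2 ≤ m) (hmk : m < k) :
    IsEmpty (cycleGraph m →g cycleGraph k) := by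
  refine ⟨fun ψ => ?_⟩
  obtain ⟨k, rfl⟩ := Nat.exists_eq_succ_of_ne_zero (by omega : k ≠ 0)
  obtain ⟨v, hv⟩ : ∃ v, ∀ i, ψ i ≠ v := by
    by_contra! h
    have := Fintype.card_le_of_surjective ψ h
    simp only [Fintype.card_fin] at this
    omega
  have parity (a b : Fin (k + 1)) (ha : a ≠ v) (hab : a = b + 1) :
      (a - v).val = (b - v).val + 1 := by
    have hsub : a - v = b - v + 1 := by rw [hab, add_sub_right_comm]
    have hlast : b - v ≠ Fin.last k := fun h =>
      sub_ne_zero.2 ha (by rw [hsub, h, Fin.last_add_one])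
    rw [hsub, Fin.val_add_one, if_neg hlast]
  have coloring : (cycleGraph m).Coloring Bool :=
    Coloring.mk (fun i => decide (Even (ψ i - v).val)) fun {i j} hij => by
      rcases (cycleGraph_succ_adj.1 (ψ.map_adj hij)).2 with h | h
      · simp [parity _ _ (hv i) h, Nat.even_add_one, -Nat.not_even_iff_odd]
      · simp [parity _ _ (hv j) h, Nat.even_add_one, -Nat.not_even_iff_odd]
  have := coloring.colorable.chromaticNumber_le
  rw [chromaticNumber_cycleGraph_of_odd m hm2 hm] at this
  exact absurd this (by decide)

theorem div_le_card_fiber_ofNat (n : ℕ) {k : ℕ} [NeZero k] (w : Fin k) :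
    n / k ≤ #{x : Fin n | Fin.ofNat k x = w} := by
  have hlt (t : Fin (n / k)) : w.val + k * t.val < n :=
    calc w.val + k * t.val < k * (t.val + 1) := by rw [mul_add_one, add_comm]; gcongr; exact w.2
      _ ≤ k * (n / k) := Nat.mul_le_mul_left k t.2
      _ ≤ n := Nat.mul_div_le n k
  calc n / k = #(univ : Finset (Fin (n / k))) := by simp
    _ ≤ _ := card_le_card_of_injOn (fun t => ⟨w.val + k * t.val, hlt t⟩)
      (fun t _ => by simp [Fin.ext_iff, Nat.mod_eq_of_lt w.2])
      fun t _ t' _ h => by simpa [NeZero.ne k, Fin.ext_iff] using h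

end Cycles

section CopyCount

variable {V : Type*} [Fintype V] (G : SimpleGraph V) [DecidableRel G.Adj]

theorem labelledCopyCount_cycleGraph_le_card_cycleHoms {k : ℕ} [NeZero k] (hk : 2 ≤ k) :
    G.labelledCopyCount (cycleGraph k) ≤ #(cycleHoms G k) := by
  obtain ⟨m, rfl⟩ := Nat.exists_eq_add_of_le' hk
  refine labelledCopyCount_le_card_of_forall_mem fun f =>
    mem_cycleHoms.2 fun i : Fin (m + 2) => f.toHom.map_adj (cycleGraph_succ_adj.2 ⟨?_, Or.inr rfl⟩)
  exact fun h => zero_ne_one (left_eq_add.1 h).symm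

theorem two_mul_copyCount_cycleGraph_le_card_cycleHoms {k : ℕ} [NeZero k] (hk : 3 ≤ k) :
    2 * k * G.copyCount (cycleGraph k) ≤ #(cycleHoms G k) :=
  calc 2 * k * G.copyCount (cycleGraph k)
      ≤ Nat.card (cycleGraph k ≃g cycleGraph k) * G.copyCount (cycleGraph k) :=
        Nat.mul_le_mul_right _ (two_mul_le_card_cycleGraph_iso hk)
    _ ≤ G.labelledCopyCount (cycleGraph k) := card_iso_mul_copyCount_le _ G
    _ ≤ #(cycleHoms G k) := labelledCopyCount_cycleGraph_le_card_cycleHoms G (by omega)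

end CopyCount

section Asymptotics

open Filter

theorem eventually_div_pow_sub_le {k : ℕ} {c : ℝ} (hc : 0 < c) :
    ∀ᶠ n : ℕ in atTop, (n / k : ℝ) ^ k - c * (n : ℝ) ^ k ≤ ((n / k : ℕ) : ℝ) ^ k := by
  have floor_div_tendsto : Tendsto (fun n : ℕ => (((n / k : ℕ) : ℝ) / n) ^ k) atTop
      (nhds ((k : ℝ)⁻¹ ^ k)) := by
    refine (((tendsto_nat_floor_mul_div_atTop (by positivity : 0 ≤ (k : ℝ)⁻¹)).comp
      tendsto_natCast_atTop_atTop).pow k).congr fun n => ?_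
    simp only [comp_apply, ← Nat.floor_div_eq_div (K := ℝ), inv_mul_eq_div]
  filter_upwards [floor_div_tendsto.eventually_const_lt (sub_lt_self _ hc), eventually_gt_atTop 0]
    with n hn hn0
  calc (n / k : ℝ) ^ k - c * (n : ℝ) ^ k = ((k : ℝ)⁻¹ ^ k - c) * (n : ℝ) ^ k := by
        rw [div_eq_mul_inv, mul_pow]; ring
    _ ≤ (((n / k : ℕ) : ℝ) / n) ^ k * (n : ℝ) ^ k := by gcongr
    _ = ((n / k : ℕ) : ℝ) ^ k := by rw [← mul_pow, div_mul_cancel₀ _ (by positivity)]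

theorem div_pow_le_generalizedTuranNumber {k m : ℕ} (hm : Odd m) (hm2 : 2 ≤ m) (hmk : m < k)
    (n : ℕ) : (n / k) ^ k ≤ generalizedTuranNumber n (cycleGraph k) (cycleGraph m) := by
  classical
  have : NeZero k := ⟨by omega⟩
  let color (x : Fin n) : Fin k := Fin.ofNat k x
  have blowup_free : (cycleGraph m).Free ((cycleGraph k).comap color) := fun ⟨f⟩ =>
    (isEmpty_cycleGraph_hom hm hm2 hmk).false ((Hom.comap color _).comp f.toHom)
  calc (n / k) ^ k = ∏ _w : Fin k, n / k := by simp
    _ ≤ ∏ w, #{x | color x = w} := prod_le_prod' fun w _ => div_le_card_fiber_ofNat n w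
    _ ≤ ((cycleGraph k).comap color).copyCount (cycleGraph k) :=
        prod_card_fiber_le_copyCount_comap _ color
    _ ≤ _ := le_sup (f := fun G : SimpleGraph (Fin n) => G.copyCount (cycleGraph k))
        (by simpa using blowup_free)

theorem card_cycleHoms_le_of_free_sub_two {V : Type*} [Fintype V] [Nonempty V] {G : SimpleGraph V}
    [DecidableRel G.Adj] {k : ℕ} [NeZero k] (hk : Odd k) (hk7 : 7 ≤ k) {δ : ℝ} (hδ : 0 < δ)
    (hδ1 : δ ≤ 1) (hn : ((k - 2 : ℕ) : ℝ) ^ 2 ≤ (δ ^ 3) ^ 4 ^ (k - 2) * Fintype.card V)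
    (hG : (cycleGraph (k - 2)).Free G) :
    (#(cycleHoms G k) : ℝ) ≤ 2 * k * (Fintype.card V / k : ℝ) ^ k
      + (4 * k ^ 4 + 2 * k) * δ * (Fintype.card V : ℝ) ^ k := by
  classical
  have : NeZero (k - 2) := ⟨by omega⟩
  have hkodd : Odd (k - 2) := Nat.Odd.sub_even (by omega) hk even_two
  have hε1 : δ ^ 3 ≤ 1 := pow_le_one₀ hδ.le hδ1
  have trace_le : (G.adjMatrix ℝ ^ (k - 2)).trace
      ≤ (δ ^ 3) ^ 4 ^ (k - 2) * (Fintype.card V : ℝ) ^ (k - 2) :=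
    calc (G.adjMatrix ℝ ^ (k - 2)).trace
        ≤ ((k - 2 : ℕ) : ℝ) ^ 2 * (Fintype.card V : ℝ) ^ (k - 2 - 1) :=
          trace_adjMatrix_pow_le_of_free hG
      _ ≤ (δ ^ 3) ^ 4 ^ (k - 2) * Fintype.card V * (Fintype.card V : ℝ) ^ (k - 2 - 1) := by gcongr
      _ = _ := by rw [mul_assoc, ← pow_succ', Nat.sub_add_cancel (by omega)]
  calc (#(cycleHoms G k) : ℝ)
      ≤ 2 * k * (Fintype.card V / k : ℝ) ^ k
        + (4 * k ^ 4 * (δ ^ 3 / δ ^ 2) + k * δ ^ 3 + k * δ) * (Fintype.card V : ℝ) ^ k :=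
        card_cycleHoms_le hk hk7 (by positivity) hδ hδ1 fun l hl h3 hlk =>
          trace_adjMatrix_pow_le_of_odd G hkodd (by positivity) hε1 trace_le hl h3 hlk
    _ ≤ 2 * k * (Fintype.card V / k : ℝ) ^ k
        + (4 * k ^ 4 * δ + k * δ + k * δ) * (Fintype.card V : ℝ) ^ k := by
        gcongr
        · rw [pow_succ' δ 2, mul_div_cancel_right₀ _ (by positivity)]
        · exact pow_le_of_le_one hδ.le hδ1 three_ne_zero
    _ = _ := by ring

theorem eventually_generalizedTuranNumber_le {k : ℕ} (hk : Odd k) (hk7 : 7 ≤ k) {c : ℝ}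
    (hc : 0 < c) : ∀ᶠ n : ℕ in atTop,
      (generalizedTuranNumber n (cycleGraph k) (cycleGraph (k - 2)) : ℝ)
        ≤ (n / k : ℝ) ^ k + c * (n : ℝ) ^ k := by
  classical
  have : NeZero k := ⟨by omega⟩
  have : (0 : ℝ) < k := by exact_mod_cast (by omega : 0 < k)
  obtain ⟨δ, hδ, hδ1, hδc⟩ : ∃ δ : ℝ, 0 < δ ∧ δ ≤ 1 ∧ (4 * k ^ 4 + 2 * k) * δ ≤ 2 * k * c :=
    ⟨min 1 (2 * k * c / (4 * k ^ 4 + 2 * k)), by positivity, min_le_left _ _,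
      (le_div_iff₀' (by positivity)).1 (min_le_right _ _)⟩
  have eventually_large : ∀ᶠ n : ℕ in atTop,
      ((k - 2 : ℕ) : ℝ) ^ 2 ≤ (δ ^ 3) ^ 4 ^ (k - 2) * (n : ℝ) :=
    (tendsto_natCast_atTop_atTop.const_mul_atTop (by positivity)).eventually_ge_atTop _
  filter_upwards [eventually_large, eventually_gt_atTop 0] with n hn hn0
  have : Nonempty (Fin n) := ⟨⟨0, hn0⟩⟩
  have bound_nonneg : 0 ≤ (n / k : ℝ) ^ k + c * (n : ℝ) ^ k := by positivity
  rw [← Nat.le_floor_iff bound_nonneg, generalizedTuranNumber, Finset.sup_le_iff]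
  intro G hG
  rw [Nat.le_floor_iff bound_nonneg]
  refine le_of_mul_le_mul_left ?_ (by positivity : (0 : ℝ) < 2 * k)
  calc 2 * k * (G.copyCount (cycleGraph k) : ℝ)
      ≤ #(cycleHoms G k) := by
        exact_mod_cast two_mul_copyCount_cycleGraph_le_card_cycleHoms (k := k) G (by omega)
    _ ≤ 2 * k * (n / k : ℝ) ^ k + (4 * k ^ 4 + 2 * k) * δ * (n : ℝ) ^ k := by
        simpa only [Fintype.card_fin] using card_cycleHoms_le_of_free_sub_two (G := G) hk hk7 hδ hδ1
          (by rwa [Fintype.card_fin]) (by simpa using hG)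
    _ ≤ 2 * k * (n / k : ℝ) ^ k + 2 * k * c * (n : ℝ) ^ k := by gcongr
    _ = _ := by ring

end Asymptotics

end CycleTuran

theorem mainTheorem2 (k : ℕ) (hk : Odd k) (hk7 : 7 ≤ k) :
    Asymptotics.IsLittleO Filter.atTop
      (fun n : ℕ =>
        (SimpleGraph.generalizedTuranNumber n
          (SimpleGraph.cycleGraph k) (SimpleGraph.cycleGraph (k - 2)) : ℝ)
          - ((n : ℝ) / (k : ℝ)) ^ k)
      (fun n : ℕ => (n : ℝ) ^ k) := by
  rw [Asymptotics.isLittleO_iff]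
  intro c hc
  filter_upwards [CycleTuran.eventually_generalizedTuranNumber_le hk hk7 hc,
    CycleTuran.eventually_div_pow_sub_le hc] with n upper floor
  have lower : (((n / k : ℕ)) : ℝ) ^ k ≤ (SimpleGraph.generalizedTuranNumber n
      (SimpleGraph.cycleGraph k) (SimpleGraph.cycleGraph (k - 2)) : ℝ) := by
    exact_mod_cast CycleTuran.div_pow_le_generalizedTuranNumber
      (Nat.Odd.sub_even (by omega) hk even_two) (by omega) (by omega) n
  rw [Real.norm_eq_abs, Real.norm_of_nonneg (by positivity), abs_sub_le_iff]
  exact ⟨sub_le_iff_le_add'.2 upper, sub_le_comm.1 (floor.trans lower)⟩
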